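/- Let $\mathcal C$ be a finite set of constructors with arities and a fixed enumeration $c_1,\dots,c_n$, containing at least one constant, and let $\mathcal T(\mathcal C)$ be the set of closed terms over $\mathcal C$. The *general safe recursive* functions $f(x_1,\dots,x_k;y_1,\dots,y_l)$ on $\mathcal T(\mathcal C)$ ($k$ normal and $l$ safe arguments) form the least class that contains the constants, the constructors $(;\vec x)\mapsto c_j(\vec x)$, all projections, the predecessors $P_{i,j}(;c_i(\vec x))=x_j$ and $P_{i,0}(;c_i)=c_i$ for constants $c_i$ (in both cases returning any other argument unchanged) and the conditional $(;c_j(\vec x),y_1,\dots,y_n)\mapsto y_j$, and that is closed under safe composition $$f(\vec x;\vec y)=h(x_{j_1},\dots,x_{j_m};g_1(\vec x;\vec y),\dots,g_q(\vec x;\vec y))$$ and general safe recursion, where for every constructor $c_j$, of arity $a$, $$f(c_j(x_1,\dots,x_a),\vec y;\vec z)=h_j(\vec x,\vec y;\vec z,f(x_1,\vec y;\vec z),\dots,f(x_a,\vec y;\vec z)).$$ Let $\mathcal F\supseteq\mathcal C$ be a finite signature whose symbols have separated normal and safe argument positions, its constructors being those of $\mathcal C$, with safe positions only, and all other symbols being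 *defined*. Labeled graphs over $\mathcal F$ are finite and acyclic; unlabeled nodes act as variables and have no successors. A *term graph* is a labeled graph with a root from which all nodes are reachable; it is *closed* if all nodes are labeled, and *basic* if its root carries a defined symbol and all labels below the root are constructors. Write $G{\restriction}v$ for the subgraph rooted at $v$, and $\mathrm{nrm}(v)$ for the set of successors of $v$ at normal positions. A *rewrite rule* $(G,l,r)$ is a labeled graph with two distinct nodes such that both $G{\restriction}l$ and $G{\restriction}r$ satisfy argument separation: for each node $v$, among the paths to $v$ that start at a defined symbol and then run through constructors only, either all leave the defined symbol at a normal position or all leave it at a safe one. A *redex* is a (not necessarily injective) homomorphism $\varphi$ from $G{\restriction}l$ into a term graph; a rewrite step adds the nodes of $G{\restriction}r$ outside $G{\restriction}l$, redirects the edges into $\varphi(l)$ (and the root, if it is $\varphi(l)$) to the node corresponding to $r$, and removes the nodes unreachable from the root. Graphs are taken up to isomorphism, and $\to^m$ is $m$-fold rewriting, with no restriction on the strategy. A *graph rewrite system* (GRS) is a set of rules. It is a *constructor* GRS if, in each rule, $l$ carries a defined symbol and all other labels in $G{\restriction}l$ are constructors. It is *safe recursive* if it consists of a (possibly infinite) set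 of safe recursive unfolding rules and finitely many rules of type (a) or (b). - *Safe recursive unfolding rule* defining $f$, over disjoint sets of symbols $\Sigma,\Theta\not\ni f$ with a bijection $\beta:\Sigma\to\Theta$, where $f$ has $1+k$ normal and $l$ safe positions and $\beta(g)$ has $\mathrm{arity}(g)+k$ normal and $l+\mathrm{arity}(g)$ safe positions: the nodes are $y$, $v_1,\dots,v_m$, $w_1,\dots,w_m$ ($m\ge1$), $x_1,\dots,x_k$, $z_1,\dots,z_l$, all distinct, the left root is $y$ and the right root is $w_1$; the $x_i,z_i$ are unlabeled; $y$ is labeled $f$ and has successors $v_1,\vec x;\vec z$; the nodes below $v_1$ are exactly $v_1,\dots,v_m$, with labels in $\Sigma$; and if $v_j$ has label $g$ and successors $v_{j_1},\dots,v_{j_a}$, then $w_j$ has label $\beta(g)$ and successors $v_{j_1},\dots,v_{j_a},\vec x;\vec z,w_{j_1},\dots,w_{j_a}$. - (a) $r$ is a node of $G{\restriction}l$ other than $l$. - (b) The nodes are $l$, $r$, $x_1,\dots,x_k$, $z_1,\dots,z_p$, $w_1,\dots,w_q$, all distinct; $\vec x,\vec z$ are unlabeled and the others labeled; $l$ and each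 $w_i$ have successors $\vec x;\vec z$; and $r$ has successors $x_{j_1},\dots,x_{j_m};w_1,\dots,w_q$. A GRS *defines* $f$ if some defined symbol $d$ with the same numbers of normal and safe positions as $f$ satisfies the following for every term graph $G$ whose root is labeled $d$ and whose argument subgraphs are constructor graphs unfolding to terms $\vec s;\vec t$: every constructor graph to which $G$ rewrites unfolds to $f(\vec s;\vec t)$; and if each normal argument subgraph of $G$ is maximally shared (no two of its nodes unfold to the same term), then $G$ rewrites to such a constructor graph, and every normal form of $G$ is one. **Theorem.** For every general safe recursive function $f$ over $\mathcal C$ there exist a constructor safe recursive GRS $\mathcal G$ over a signature $\mathcal F\supseteq\mathcal C$ as above that defines $f$, and a polynomial $p:\mathbb N\to\mathbb N$, such that for every closed basic term graph $G$ and every term graph $H$ over $\mathcal F$ with $G\to_{\mathcal G}^m H$, writing $N=\bigcup_{v\in\mathrm{nrm}(\mathrm{root}_G)}V_{G\restriction v}$: 1. $m\le p(|N|)$; 2. $|H|\le p(|N|)+|V_G\setminus N|$, where $|H|$ is the number of nodes of $H$. -/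

import Mathlib

noncomputable section

namespace GRS

/-! ### Terms over the constructors and general safe recursive functions -/

/-- Closed terms over a set `C` of constructors with arities `ar`. -/
inductive Tm {C : Type} (ar : C → ℕ) : Type
  | mk (c : C) (a : Fin (ar c) → Tm ar) : Tm ar

/-- The outermost constructor of a term. -/
def Tm.head {C : Type} {ar : C → ℕ} : Tm ar → C
  | .mk c _ => c

open Classical in
/-- The predecessor: it maps `c(x₁, …, xₐ)` to `x_j`. It is totalised on the terms that do not
start with `c` by leaving them unchanged. (Any other totalisation by a fixed term or by the
argument gives the same class of functions, because of the conditional.) -/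
def Tm.pred {C : Type} {ar : C → ℕ} (c : C) (j : Fin (ar c)) : Tm ar → Tm ar
  | .mk b a => if h : b = c then a (Fin.cast (congrArg ar h.symm) j) else .mk b a

/-- `GSR ar e k l f`: the function `f(x₁, …, x_k ; y₁, …, y_l)`, with `k` normal and `l` safe
arguments, is general safe recursive over the constructors `C`, which are enumerated by `e`. -/
inductive GSR {C : Type} (ar : C → ℕ) {n : ℕ} (e : Fin n ≃ C) :
    (k l : ℕ) → ((Fin k → Tm ar) → (Fin l → Tm ar) → Tm ar) → Prop
  /-- Constants. -/
  | const (k l : ℕ) (c : C) (hc : ar c = 0) :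
      GSR ar e k l (fun _ _ => .mk c (fun i => (Fin.cast hc i).elim0))
  /-- Constructors. -/
  | constr (c : C) (hc : ar c ≠ 0) : GSR ar e 0 (ar c) (fun _ y => .mk c y)
  /-- Projections to a normal argument. -/
  | projNormal (k l : ℕ) (j : Fin k) : GSR ar e k l (fun x _ => x j)
  /-- Projections to a safe argument. -/
  | projSafe (k l : ℕ) (j : Fin l) : GSR ar e k l (fun _ y => y j)
  /-- The predecessor `P(; c) = c` of a constant `c`, totalised in the same way. -/
  | predConst (c : C) (hc : ar c = 0) : GSR ar e 0 1 (fun _ y => y 0)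
  /-- The predecessors `P(; c(x₁, …, xₐ)) = x_j`. -/
  | pred (c : C) (j : Fin (ar c)) : GSR ar e 0 1 (fun _ y => Tm.pred c j (y 0))
  /-- The conditional `C(; c_j(…), y₁, …, y_n) = y_j`. -/
  | cond : GSR ar e 0 (n + 1) (fun _ y => y (Fin.succ (e.symm (Tm.head (y 0)))))
  /-- Safe composition `h(x_{j₁}, …, x_{j_m} ; g₁(x ; y), …, g_q(x ; y))`. -/
  | comp {k l m q : ℕ} (j : Fin m → Fin k)
      (h : (Fin m → Tm ar) → (Fin q → Tm ar) → Tm ar)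
      (g : Fin q → (Fin k → Tm ar) → (Fin l → Tm ar) → Tm ar)
      (hh : GSR ar e m q h) (hg : ∀ i, GSR ar e k l (g i)) :
      GSR ar e k l (fun x y => h (fun i => x (j i)) (fun i => g i x y))
  /-- General safe recursion
  `f(c(x), y ; z) = h_c(x, y ; z, f(x₁, y ; z), …, f(xₐ, y ; z))`, for every constructor `c`. -/
  | safeRec {k l : ℕ} (f : (Fin (k + 1) → Tm ar) → (Fin l → Tm ar) → Tm ar)
      (h : ∀ c : C, (Fin (ar c + k) → Tm ar) → (Fin (l + ar c) → Tm ar) → Tm ar)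
      (hh : ∀ c, GSR ar e (ar c + k) (l + ar c) (h c))
      (hf : ∀ (c : C) (x : Fin (ar c) → Tm ar) (y : Fin k → Tm ar) (z : Fin l → Tm ar),
        f (Fin.cons (Tm.mk c x) y) z =
          h c (Fin.append x y) (Fin.append z (fun i => f (Fin.cons (x i) y) z))) :
      GSR ar e (k + 1) l f

/-! ### Signatures and graphs -/

/-- A finite signature with argument separation whose set of constructors is `C`: the constructors
together with a finite set `D` of defined symbols, each with its numbers of normal and of safe
argument positions. -/
structure Signature {C : Type} (ar : C → ℕ) where
  D : Type
  finite_D : Finite D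
  normal : D → ℕ
  safe : D → ℕ

variable {C : Type} {ar : C → ℕ}

/-- All symbols: constructors (`inl`) and defined symbols (`inr`). -/
abbrev Signature.Sym (S : Signature ar) : Type := C ⊕ S.D

/-- Number of normal argument positions; constructors have none. -/
def Signature.nar (S : Signature ar) : S.Sym → ℕ
  | .inl _ => 0
  | .inr d => S.normal d

/-- Number of safe argument positions. -/
def Signature.sar (S : Signature ar) : S.Sym → ℕ
  | .inl c => ar c
  | .inr d => S.safe d

/-- The data of a labeled graph: a partial labeling, and the successor sequence of every node split
into its normal part `nsucc` and its safe part `ssucc`. The edges are the pairs of a node and one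
of its successors. -/
structure Graph (S : Signature ar) where
  V : Type
  lab : V → Option S.Sym
  nsucc : V → List V
  ssucc : V → List V

namespace Graph

variable {S : Signature ar}

/-- There is an edge from `u` to `v`. -/
def Edge (G : Graph S) (u v : G.V) : Prop := v ∈ G.nsucc u ∨ v ∈ G.ssucc u

/-- There is a (possibly empty) path from `u` to `v`. -/
def Reach (G : Graph S) (u v : G.V) : Prop := Relation.ReflTransGen G.Edge u v

/-- The set of nodes of the subgraph rooted at `v`. -/
def below (G : Graph S) (v : G.V) : Set G.V := {u | G.Reach v u}

/-- The numbers of successors agree with the arities, unlabeled nodes have no successors, and the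
graph is finite and acyclic. -/
structure WellFormed (G : Graph S) : Prop where
  finite : Finite G.V
  nlen : ∀ v f, G.lab v = some f → (G.nsucc v).length = S.nar f
  slen : ∀ v f, G.lab v = some f → (G.ssucc v).length = S.sar f
  unlabeled : ∀ v, G.lab v = none → G.nsucc v = [] ∧ G.ssucc v = []
  acyclic : ∀ v, ¬ Relation.TransGen G.Edge v v

/-- The subgraph rooted at `a`. -/
abbrev sub (G : Graph S) (a : G.V) : Graph S where
  V := {u : G.V // G.Reach a u}
  lab u := G.lab u.1
  nsucc u := (G.nsucc u.1).attach.map fun v =>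
    ⟨v.1, Relation.ReflTransGen.tail u.2 (Or.inl v.2)⟩
  ssucc u := (G.ssucc u.1).attach.map fun v =>
    ⟨v.1, Relation.ReflTransGen.tail u.2 (Or.inr v.2)⟩

/-- Homomorphisms of labeled graphs with argument separation; nothing is required at the unlabeled
nodes of the source, and injectivity is not required. -/
def IsHom (G H : Graph S) (φ : G.V → H.V) : Prop :=
  ∀ v f, G.lab v = some f →
    H.lab (φ v) = some f ∧ H.nsucc (φ v) = (G.nsucc v).map φ ∧ H.ssucc (φ v) = (G.ssucc v).map φ

/-- Isomorphism of the rooted graphs `(G, a)` and `(H, b)`. -/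
def RootedIso (G : Graph S) (a : G.V) (H : Graph S) (b : H.V) : Prop :=
  ∃ φ : G.V ≃ H.V, φ a = b ∧ ∀ v,
    H.lab (φ v) = G.lab v ∧ H.nsucc (φ v) = (G.nsucc v).map φ ∧ H.ssucc (φ v) = (G.ssucc v).map φ

/-- The node `v` carries a constructor. -/
def IsConsNode (G : Graph S) (v : G.V) : Prop := ∃ c : C, G.lab v = some (.inl c)

/-- The node `v` carries a defined symbol. -/
def IsDefNode (G : Graph S) (v : G.V) : Prop := ∃ d : S.D, G.lab v = some (.inr d)

/-- There is a path from `u` to `v` all of whose nodes, except possibly `v`, carry constructors. -/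
def ConsPath (G : Graph S) (u v : G.V) : Prop :=
  Relation.ReflTransGen (fun a b => G.IsConsNode a ∧ G.Edge a b) u v

/-- The condition of argument separation for the subgraph of `G` rooted at `a`: for every node `v`,
either all paths to `v` that start at a defined symbol and then run through constructors only leave
the defined symbol through a normal position, or all of them leave it through a safe position. -/
def Separated (G : Graph S) (a : G.V) : Prop :=
  ∀ v ∈ G.below a,
    (∀ u ∈ G.below a, G.IsDefNode u → ∀ s ∈ G.ssucc u, ¬ G.ConsPath s v) ∨
    (∀ u ∈ G.below a, G.IsDefNode u → ∀ s ∈ G.nsucc u, ¬ G.ConsPath s v)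

/-- `G.Denotes v t`: the subgraph rooted at `v` is closed and contains constructors only, and
unfolds to the term `t`. -/
inductive Denotes (G : Graph S) : G.V → Tm ar → Prop
  | mk (v : G.V) (c : C) (vs : Fin (ar c) → G.V) (ts : Fin (ar c) → Tm ar)
      (hlab : G.lab v = some (.inl c)) (hsucc : G.ssucc v = List.ofFn vs)
      (h : ∀ i, G.Denotes (vs i) (ts i)) : G.Denotes v (.mk c ts)

/-- The subgraph rooted at `v` is maximally shared: distinct nodes denote distinct terms. -/
def MaximallyShared (G : Graph S) (v : G.V) : Prop :=
  ∀ a ∈ G.below v, ∀ b ∈ G.below v, ∀ t, G.Denotes a t → G.Denotes b t → a = b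

end Graph

/-- A term graph: a labeled graph with a root from which all nodes are reachable. The condition of
argument separation is imposed on the two sides of rewrite rules, but not on the graphs that are
rewritten: rewriting does not preserve it (a projection to a normal argument may turn a normal
argument into a safe one that is shared), and all claims are made without it. -/
structure TermGraph (S : Signature ar) extends Graph S where
  wf : toGraph.WellFormed
  root : V
  reach : ∀ v, toGraph.Reach root v

/-- A graph rewrite rule `(graph, l, r)`. -/
structure Rule (S : Signature ar) where
  graph : Graph S
  wf : graph.WellFormed
  l : graph.V
  r : graph.V
  ne : l ≠ r
  sep_l : graph.Separated l
  sep_r : graph.Separated r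

namespace TermGraph

variable {S : Signature ar}

/-- All nodes are labeled. -/
def Closed (G : TermGraph S) : Prop := ∀ v, G.lab v ≠ none

/-- The root carries a defined symbol, and all (labeled) nodes of the subgraphs rooted at its
successors carry constructors. -/
def Basic (G : TermGraph S) : Prop :=
  G.toGraph.IsDefNode G.root ∧
    ∀ v, G.toGraph.Edge G.root v → ∀ u ∈ G.toGraph.below v, ∀ f, G.lab u = some f →
      ∃ c : C, f = .inl c

/-- The union of the node sets of the subgraphs at the normal argument positions of the root. -/
def normalPart (G : TermGraph S) : Set G.V := ⋃ v ∈ {v | v ∈ G.nsucc G.root}, G.toGraph.below v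

/-- The number of nodes. -/
def size (G : TermGraph S) : ℕ := Nat.card G.V

end TermGraph

/-! ### Rewriting

A step first adds copies of those nodes of the rule that do not belong to its left hand side, then
redirects all edges (and, if need be, the root) that point to the image of the left root to the node
that corresponds to the right root, and finally removes the nodes that are not reachable from the
root. -/

section Rewriting

variable {S : Signature ar}

/-- The place in the extended graph of a node of the rule. -/
def place (G : Graph S) (R : Rule S) (φ : (R.graph.sub R.l).V → G.V) (w : R.graph.V) :
    G.V ⊕ {w : R.graph.V // ¬ R.graph.Reach R.l w} :=
  open Classical in if h : R.graph.Reach R.l w then .inl (φ ⟨w, h⟩) else .inr ⟨w, h⟩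

/-- Redirection from the image of the left root to the node corresponding to the right root. -/
def redirect (G : Graph S) (R : Rule S) (φ : (R.graph.sub R.l).V → G.V)
    (p : G.V ⊕ {w : R.graph.V // ¬ R.graph.Reach R.l w}) :
    G.V ⊕ {w : R.graph.V // ¬ R.graph.Reach R.l w} :=
  open Classical in if p = place G R φ R.l then place G R φ R.r else p

/-- The extended graph after redirection, before the removal of unreachable nodes. -/
abbrev extended (G : Graph S) (R : Rule S) (φ : (R.graph.sub R.l).V → G.V) : Graph S where
  V := G.V ⊕ {w : R.graph.V // ¬ R.graph.Reach R.l w}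
  lab := Sum.elim G.lab (fun w => R.graph.lab w.1)
  nsucc := Sum.elim (fun v => (G.nsucc v).map (fun u => redirect G R φ (.inl u)))
    (fun w => (R.graph.nsucc w.1).map (fun u => redirect G R φ (place G R φ u)))
  ssucc := Sum.elim (fun v => (G.ssucc v).map (fun u => redirect G R φ (.inl u)))
    (fun w => (R.graph.ssucc w.1).map (fun u => redirect G R φ (place G R φ u)))

/-- `G` rewrites to `H` in one step; term graphs are taken up to isomorphism. -/
def Step (𝒢 : Set (Rule S)) (G H : TermGraph S) : Prop :=
  ∃ R ∈ 𝒢, ∃ φ : (R.graph.sub R.l).V → G.V,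
    Graph.IsHom (R.graph.sub R.l) G.toGraph φ ∧
    Graph.RootedIso
      ((extended G.toGraph R φ).sub (redirect G.toGraph R φ (.inl G.root)))
      ⟨redirect G.toGraph R φ (.inl G.root), Relation.ReflTransGen.refl⟩
      H.toGraph H.root

/-- `G` rewrites to `H` in exactly `m` steps. -/
inductive Steps (𝒢 : Set (Rule S)) : ℕ → TermGraph S → TermGraph S → Prop
  | zero (G : TermGraph S) : Steps 𝒢 0 G G
  | succ {m : ℕ} {G H K : TermGraph S} (h : Steps 𝒢 m G H) (hs : Step 𝒢 H K) :
      Steps 𝒢 (m + 1) G K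

/-- No step is possible from `G`. -/
def NormalForm (𝒢 : Set (Rule S)) (G : TermGraph S) : Prop := ∀ H, ¬ Step 𝒢 G H

end Rewriting

/-! ### Safe recursive graph rewrite systems -/

section Systems

variable {S : Signature ar}

/-- A constructor rule. -/
def Rule.IsConstructor (R : Rule S) : Prop :=
  R.graph.IsDefNode R.l ∧
    ∀ v ∈ R.graph.below R.l, v ≠ R.l → ∀ f, R.graph.lab v = some f → ∃ c : C, f = .inl c

/-- The data that make `R` a safe recursive unfolding graph rewrite rule over the signatures `A` and
`B`, in bijection by `β`, that defines the symbol `f`. The nodes are `y`, `v₁, …, v_{m+1}`,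
`w₁, …, w_{m+1}`, the normal parameters `x₁, …, x_k` and the safe parameters `z₁, …, z_l`. -/
structure SafeUnfolding (R : Rule S) where
  A : Set S.Sym
  B : Set S.Sym
  disj : Disjoint A B
  β : S.Sym → S.Sym
  bij : Set.BijOn β A B
  k : ℕ
  l : ℕ
  nar_β : ∀ g ∈ A, S.nar (β g) = (S.nar g + S.sar g) + k
  sar_β : ∀ g ∈ A, S.sar (β g) = l + (S.nar g + S.sar g)
  f : S.Sym
  f_notMem : f ∉ A ∪ B
  nar_f : S.nar f = 1 + k
  sar_f : S.sar f = l
  m : ℕ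
  y : R.graph.V
  v : Fin (m + 1) → R.graph.V
  w : Fin (m + 1) → R.graph.V
  x : Fin k → R.graph.V
  z : Fin l → R.graph.V
  nodes : Function.Bijective
    (Sum.elim (fun _ : Unit => y) (Sum.elim v (Sum.elim w (Sum.elim x z))))
  l_eq : R.l = y
  r_eq : R.r = w 0
  lab_y : R.graph.lab y = some f
  nsucc_y : R.graph.nsucc y = v 0 :: List.ofFn x
  ssucc_y : R.graph.ssucc y = List.ofFn z
  lab_x : ∀ j, R.graph.lab (x j) = none
  lab_z : ∀ j, R.graph.lab (z j) = none
  s : Fin (m + 1) → List (Fin (m + 1))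
  succ_v : ∀ j, R.graph.nsucc (v j) ++ R.graph.ssucc (v j) = (s j).map v
  below_v : R.graph.below (v 0) = Set.range v
  lab_v : ∀ j, ∃ g ∈ A, R.graph.lab (v j) = some g ∧ R.graph.lab (w j) = some (β g)
  nsucc_w : ∀ j, R.graph.nsucc (w j) = (s j).map v ++ List.ofFn x
  ssucc_w : ∀ j, R.graph.ssucc (w j) = List.ofFn z ++ (s j).map w

/-- The right hand side is a proper subgraph of the left hand side. -/
def Rule.IsSubgraphRule (R : Rule S) : Prop := R.r ∈ R.graph.below R.l ∧ R.r ≠ R.l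

/-- The data that make `R` a rule
`f(x ; z) → h(x_{j₁}, …, x_{j_m} ; g₁(x ; z), …, g_q(x ; z))`. -/
structure SafeComposition (R : Rule S) where
  k : ℕ
  l : ℕ
  m : ℕ
  q : ℕ
  u : R.graph.V
  v : R.graph.V
  x : Fin k → R.graph.V
  z : Fin l → R.graph.V
  w : Fin q → R.graph.V
  nodes : Function.Bijective
    (Sum.elim (fun _ : Unit => u) (Sum.elim (fun _ : Unit => v) (Sum.elim x (Sum.elim z w))))
  l_eq : R.l = u
  r_eq : R.r = v
  lab_u : R.graph.lab u ≠ none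
  lab_v : R.graph.lab v ≠ none
  lab_w : ∀ i, R.graph.lab (w i) ≠ none
  lab_x : ∀ i, R.graph.lab (x i) = none
  lab_z : ∀ i, R.graph.lab (z i) = none
  nsucc_u : R.graph.nsucc u = List.ofFn x
  ssucc_u : R.graph.ssucc u = List.ofFn z
  j : Fin m → Fin k
  nsucc_v : R.graph.nsucc v = List.ofFn (fun i => x (j i))
  ssucc_v : R.graph.ssucc v = List.ofFn w
  nsucc_w : ∀ i, R.graph.nsucc (w i) = List.ofFn x
  ssucc_w : ∀ i, R.graph.ssucc (w i) = List.ofFn z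

/-- A constructor graph rewrite system. -/
def IsConstructorSystem (𝒢 : Set (Rule S)) : Prop := ∀ R ∈ 𝒢, R.IsConstructor

/-- A safe recursive graph rewrite system: a possibly infinite set of safe recursive unfolding graph
rewrite rules together with finitely many rules of the two other shapes. -/
def IsSafeRecursive (𝒢 : Set (Rule S)) : Prop :=
  ∃ 𝒰 ℱ : Set (Rule S), 𝒢 = 𝒰 ∪ ℱ ∧ (∀ R ∈ 𝒰, Nonempty (SafeUnfolding R)) ∧
    ℱ.Finite ∧ ∀ R ∈ ℱ, R.IsSubgraphRule ∨ Nonempty (SafeComposition R)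

/-- The system `𝒢` defines the function `f(x₁, …, x_k ; y₁, …, y_l)`: there is a defined symbol `d`
with `k` normal and `l` safe positions such that, for every term graph of the form `d(x ; y)` whose
arguments denote constructor terms, every term denoted by a reduct is the value of `f`; and such
that, if moreover the normal arguments are each represented with maximal sharing, the value is
reached and all normal forms denote it. The representation of the safe arguments, and the sharing
between distinct arguments, are arbitrary. -/
def Defines (𝒢 : Set (Rule S)) {k l : ℕ}
    (f : (Fin k → Tm ar) → (Fin l → Tm ar) → Tm ar) : Prop :=
  ∃ d : S.D, S.normal d = k ∧ S.safe d = l ∧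
    ∀ (G : TermGraph S) (v : Fin k → G.V) (w : Fin l → G.V)
      (x : Fin k → Tm ar) (y : Fin l → Tm ar),
      G.lab G.root = some (.inr d) →
      G.nsucc G.root = List.ofFn v → G.ssucc G.root = List.ofFn w →
      (∀ i, G.toGraph.Denotes (v i) (x i)) → (∀ i, G.toGraph.Denotes (w i) (y i)) →
      (∀ m H t, Steps 𝒢 m G H → H.toGraph.Denotes H.root t → t = f x y) ∧
      ((∀ i, G.toGraph.MaximallyShared (v i)) →
        (∃ m H, Steps 𝒢 m G H ∧ H.toGraph.Denotes H.root (f x y)) ∧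
        ∀ m H, Steps 𝒢 m G H → NormalForm 𝒢 H → H.toGraph.Denotes H.root (f x y))

end Systems

end GRS

end

/-!
A general safe recursive function is built from finitely many others, so it has a finite *program*:
a finite set `D` of symbols, each computing a function that is defined from the functions of other
symbols by one of four schemes (`Justified`, `GSR.programmable`). Each scheme is turned into rules.
Projections, predecessors and the conditional select a subgraph of the left-hand side (`patRule`);
composition, also with a constructor as head, is one rule (`compRule`); recursion gives one
unfolding rule for each *maximally shared* constructor graph at the recursion argument
(`SharedDag`, `unfRule`). Rules along graphs with less sharing are left out on purpose: they would
also match maximally shared graphs, and would then create exponentially many nodes.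

*Correctness.* An evaluation of a closed graph assigns a term to every node such that at each node
the equation given by its label holds (`EvalAt`). Both roots of a rule have the same value and the
added nodes can be evaluated consistently, so that redirection preserves all values: a step
preserves the value of the root (`Inv.extended`). At a constructor graph the value is the term it
unfolds to.

*Bounds.* All normal arguments of all nodes stay inside the set `M` of nodes below the normal
arguments of the initial root, which is never changed (`Inv`). Hence an unfolding step adds at most
as many nodes as there are terms represented in `M`, since the nodes of a maximally shared graph
represent distinct terms. So each symbol `d` can be given a polynomial `W d` whose value at
`n = |N|` exceeds the number of added nodes plus their weights (`RuleOK.weight`). Each step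
removes the root of the redex, because all edges into it are redirected; therefore it decreases
the total weight, and does not increase the number of nodes plus the total weight (`Step.inv`).
Initially the total weight is `W d` at `|N|` for the label `d` of the root.

*Completeness.* By the bound, rewriting terminates. If a reduct still has a defined symbol, then
there is one all of whose arguments are constructor graphs, and a rule applies to it, because its
normal arguments are maximally shared (`NormalForm.denotes`). That the contracted graph is again a
term graph, in particular acyclic, is `extended_wellFormed`.
-/

noncomputable section

namespace GRS

variable {C : Type} {ar : C → ℕ} {S : Signature ar}

/-! ### Acyclic graphs, subgraphs and homomorphisms -/

namespace Graph

/-- A finite acyclic graph has a rank function that decreases along edges. -/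
theorem exists_rank (G : Graph S) (hfin : Finite G.V)
    (hac : ∀ v, ¬ Relation.TransGen G.Edge v v) :
    ∃ ρ : G.V → ℕ, ∀ u v, G.Edge u v → ρ v < ρ u := by
  refine ⟨fun v => {x | Relation.TransGen G.Edge v x}.ncard, fun u v huv => ?_⟩
  refine Set.ncard_lt_ncard ⟨fun x hx => ?_, fun h => ?_⟩ (Set.toFinite _)
  · exact Relation.TransGen.head huv hx
  · exact hac v (h (Relation.TransGen.single huv))

theorem rank_lt_of_transGen {G : Graph S} {ρ : G.V → ℕ}
    (hρ : ∀ u v, G.Edge u v → ρ v < ρ u) {u v : G.V} (h : Relation.TransGen G.Edge u v) :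
    ρ v < ρ u := by
  induction h with
  | single h => exact hρ _ _ h
  | tail _ h ih => exact (hρ _ _ h).trans ih

theorem acyclic_of_rank {G : Graph S} (ρ : G.V → ℕ)
    (hρ : ∀ u v, G.Edge u v → ρ v < ρ u) (v : G.V) : ¬ Relation.TransGen G.Edge v v :=
  fun h => (rank_lt_of_transGen hρ h).false

theorem WellFormed.lab_ne_none {G : Graph S} (hG : G.WellFormed) {u v : G.V} (h : G.Edge u v) :
    G.lab u ≠ none := fun hn => by
  obtain ⟨h1, h2⟩ := hG.unlabeled u hn
  rcases h with h | h
  · simp [h1] at h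
  · simp [h2] at h

theorem WellFormed.nsucc_eq_nil {G : Graph S} (hG : G.WellFormed) {u : G.V} {c : C}
    (h : G.lab u = some (.inl c)) : G.nsucc u = [] :=
  List.length_eq_zero_iff.mp (hG.nlen u _ h)

theorem Reach.mem_of_closed {G : Graph S} {M : Set G.V} (hM : ∀ u ∈ M, ∀ v, G.Edge u v → v ∈ M)
    {u v : G.V} (hu : u ∈ M) (h : G.Reach u v) : v ∈ M := by
  induction h with
  | refl => exact hu
  | tail _ h ih => exact hM _ ih _ h

theorem sub_reach (G : Graph S) (a : G.V) (u : (G.sub a).V) :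
    (G.sub a).Reach ⟨a, Relation.ReflTransGen.refl⟩ u := by
  obtain ⟨u, hu⟩ := u
  induction hu with
  | refl => exact Relation.ReflTransGen.refl
  | tail h1 h2 ih =>
    refine Relation.ReflTransGen.tail (ih) ?_
    rcases h2 with h2 | h2
    · exact Or.inl (List.mem_map.mpr ⟨⟨_, h2⟩, List.mem_attach _ _, rfl⟩)
    · exact Or.inr (List.mem_map.mpr ⟨⟨_, h2⟩, List.mem_attach _ _, rfl⟩)

theorem sub_nsucc_map_val (G : Graph S) (a : G.V) (u : (G.sub a).V) :
    ((G.sub a).nsucc u).map Subtype.val = G.nsucc u.1 := by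
  simp [List.map_map, Function.comp_def]

theorem sub_ssucc_map_val (G : Graph S) (a : G.V) (u : (G.sub a).V) :
    ((G.sub a).ssucc u).map Subtype.val = G.ssucc u.1 := by
  simp [List.map_map, Function.comp_def]

theorem sub_edge {G : Graph S} {a : G.V} {u v : (G.sub a).V} (h : (G.sub a).Edge u v) :
    G.Edge u.1 v.1 := by
  rcases h with h | h
  · left; rw [← sub_nsucc_map_val]; exact List.mem_map_of_mem h
  · right; rw [← sub_ssucc_map_val]; exact List.mem_map_of_mem h

theorem WellFormed.sub {G : Graph S} (hG : G.WellFormed) (a : G.V) : (G.sub a).WellFormed where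
  finite := by have := hG.finite; exact Subtype.finite
  nlen v f h := by simpa using hG.nlen v.1 f h
  slen v f h := by simpa using hG.slen v.1 f h
  unlabeled v h := by
    obtain ⟨h1, h2⟩ := hG.unlabeled v.1 h
    simp [h1, h2]
  acyclic v h := by
    obtain ⟨ρ, hρ⟩ := G.exists_rank hG.finite hG.acyclic
    exact acyclic_of_rank (G := G.sub a) (fun v => ρ v.1) (fun u v h => hρ _ _ (sub_edge h)) v h

section Hom

variable {G H : Graph S} {a : G.V} {φ : (G.sub a).V → H.V}

theorem IsHom.map_nsucc (hφ : IsHom (G.sub a) H φ) {w : G.V} (hw : G.Reach a w) {s : S.Sym}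
    (hs : G.lab w = some s) {α : Type} {F : H.V → α} {F₀ : G.V → α}
    (hF : ∀ u (hu : G.Reach a u), F (φ ⟨u, hu⟩) = F₀ u) :
    (H.nsucc (φ ⟨w, hw⟩)).map F = (G.nsucc w).map F₀ := by
  rw [(hφ ⟨w, hw⟩ s hs).2.1, List.map_map]
  refine (List.map_congr_left (g := F₀ ∘ Subtype.val) fun u _ => hF u.1 u.2).trans ?_
  rw [← List.map_map, sub_nsucc_map_val]

theorem IsHom.map_ssucc (hφ : IsHom (G.sub a) H φ) {w : G.V} (hw : G.Reach a w) {s : S.Sym}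
    (hs : G.lab w = some s) {α : Type} {F : H.V → α} {F₀ : G.V → α}
    (hF : ∀ u (hu : G.Reach a u), F (φ ⟨u, hu⟩) = F₀ u) :
    (H.ssucc (φ ⟨w, hw⟩)).map F = (G.ssucc w).map F₀ := by
  rw [(hφ ⟨w, hw⟩ s hs).2.2, List.map_map]
  refine (List.map_congr_left (g := F₀ ∘ Subtype.val) fun u _ => hF u.1 u.2).trans ?_
  rw [← List.map_map, sub_ssucc_map_val]

theorem IsHom.mem_nsucc (hφ : IsHom (G.sub a) H φ) (hG : G.WellFormed) {w u : G.V}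
    (hw : G.Reach a w) (h : u ∈ G.nsucc w) :
    φ ⟨u, hw.tail (Or.inl h)⟩ ∈ H.nsucc (φ ⟨w, hw⟩) := by
  obtain ⟨s, hs⟩ := Option.ne_none_iff_exists'.mp (hG.lab_ne_none (Or.inl h))
  rw [(hφ ⟨w, hw⟩ s hs).2.1]
  exact List.mem_map_of_mem (List.mem_map.mpr ⟨⟨u, h⟩, List.mem_attach _ _, rfl⟩)

theorem IsHom.mem_ssucc (hφ : IsHom (G.sub a) H φ) (hG : G.WellFormed) {w u : G.V}
    (hw : G.Reach a w) (h : u ∈ G.ssucc w) :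
    φ ⟨u, hw.tail (Or.inr h)⟩ ∈ H.ssucc (φ ⟨w, hw⟩) := by
  obtain ⟨s, hs⟩ := Option.ne_none_iff_exists'.mp (hG.lab_ne_none (Or.inr h))
  rw [(hφ ⟨w, hw⟩ s hs).2.2]
  exact List.mem_map_of_mem (List.mem_map.mpr ⟨⟨u, h⟩, List.mem_attach _ _, rfl⟩)

theorem IsHom.edge (hφ : IsHom (G.sub a) H φ) (hG : G.WellFormed) {w u : G.V}
    (hw : G.Reach a w) (h : G.Edge w u) :
    H.Edge (φ ⟨w, hw⟩) (φ ⟨u, hw.tail h⟩) :=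
  h.elim (fun h => Or.inl (hφ.mem_nsucc hG hw h)) (fun h => Or.inr (hφ.mem_ssucc hG hw h))

theorem IsHom.reach (hφ : IsHom (G.sub a) H φ) (hG : G.WellFormed) {w u : G.V}
    (hw : G.Reach a w) (h : G.Reach w u) :
    H.Reach (φ ⟨w, hw⟩) (φ ⟨u, hw.trans h⟩) := by
  induction h with
  | refl => exact Relation.ReflTransGen.refl
  | tail h1 h2 ih => exact ih.tail (hφ.edge hG (hw.trans h1) h2)

/-- In an acyclic graph a homomorphism separates the root from the other nodes. -/
theorem IsHom.ne_root (hφ : IsHom (G.sub a) H φ) (hG : G.WellFormed) (hH : H.WellFormed) {w : G.V}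
    (hw : G.Reach a w) (hne : w ≠ a) : φ ⟨w, hw⟩ ≠ φ ⟨a, Relation.ReflTransGen.refl⟩ := by
  intro h
  rcases Relation.ReflTransGen.cases_head hw with h0 | ⟨b, hab, hbw⟩
  · exact hne h0.symm
  · have h1 := hφ.edge hG Relation.ReflTransGen.refl hab
    have h2 := hφ.reach hG (Relation.ReflTransGen.refl.tail hab) hbw
    have h3 := Relation.TransGen.head' h1 h2
    rw [h] at h3
    exact hH.acyclic _ h3

end Hom

end Graph

/-! ### Evaluation of graphs -/

/-- An interpretation of all symbols of a signature by functions on terms, given on the lists of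
the normal and of the safe arguments. Constructors are interpreted by themselves. -/
structure Interp (S : Signature ar) where
  val : S.Sym → List (Tm ar) → List (Tm ar) → Tm ar
  val_constr : ∀ c ys, val (.inl c) [] (List.ofFn ys) = .mk c ys

/-- The values `ε` satisfy the equation that the label of `v` imposes at `v`. -/
def EvalAt (J : Interp S) (G : Graph S) (ε : G.V → Tm ar) (v : G.V) : Prop :=
  ∀ s, G.lab v = some s → ε v = J.val s ((G.nsucc v).map ε) ((G.ssucc v).map ε)

theorem EvalAt.congr {J : Interp S} {G : Graph S} {ε ε' : G.V → Tm ar} {v : G.V}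
    (h : EvalAt J G ε v) (hv : ε' v = ε v) (hs : ∀ u, G.Edge v u → ε' u = ε u) :
    EvalAt J G ε' v := by
  intro s hl
  rw [hv, h s hl, List.map_congr_left fun u hu => hs u (Or.inl hu),
    List.map_congr_left fun u hu => hs u (Or.inr hu)]

namespace Graph

/-- The value of a constructor graph is the term that it unfolds to. -/
theorem Denotes.eval {J : Interp S} {G : Graph S} (hG : G.WellFormed) {ε : G.V → Tm ar}
    (hε : ∀ v, EvalAt J G ε v) {v : G.V} {t : Tm ar} (h : G.Denotes v t) : ε v = t := by
  induction h with
  | mk v c vs ts hlab hsucc _ ih =>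
    rw [hε v _ hlab, hG.nsucc_eq_nil hlab, hsucc, List.map_ofFn, List.map_nil, J.val_constr]
    congr 1
    exact funext ih

theorem exists_ofFn_ssucc {G : Graph S} (hG : G.WellFormed) {v : G.V} {c : C}
    (hlab : G.lab v = some (.inl c)) : ∃ vs : Fin (ar c) → G.V, G.ssucc v = List.ofFn vs := by
  have hlen : (G.ssucc v).length = ar c := hG.slen v _ hlab
  refine ⟨fun i => (G.ssucc v).get (i.cast hlen.symm), ?_⟩
  apply List.ext_getElem <;> simp [hlen]

/-- A node below which there are only constructors denotes a term. -/
theorem exists_denotes {G : Graph S} (hG : G.WellFormed) (v : G.V)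
    (h : ∀ u, G.Reach v u → G.IsConsNode u) : ∃ t, G.Denotes v t := by
  obtain ⟨ρ, hρ⟩ := G.exists_rank hG.finite hG.acyclic
  induction hn : ρ v using Nat.strong_induction_on generalizing v with
  | _ n ih =>
    obtain ⟨c, hc⟩ := h v Relation.ReflTransGen.refl
    obtain ⟨vs, hvs⟩ := exists_ofFn_ssucc hG hc
    have hedge : ∀ i, G.Edge v (vs i) := fun i => Or.inr (by simp [hvs])
    choose ts hts using fun i => ih (ρ (vs i)) (hn ▸ hρ _ _ (hedge i)) (vs i)
      (fun u hu => h u (Relation.ReflTransGen.head (hedge i) hu)) rfl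
    exact ⟨_, .mk v c vs ts hc hvs hts⟩

theorem Denotes.unique {G : Graph S} {v : G.V} {t t' : Tm ar} (h : G.Denotes v t)
    (h' : G.Denotes v t') : t = t' := by
  induction h generalizing t' with
  | mk v c vs ts hlab hsucc _ ih =>
    cases h' with
    | mk _ c' vs' ts' hlab' hsucc' h' =>
      obtain rfl : c = c' := by simpa [hlab] using hlab'
      obtain rfl : vs = vs' := List.ofFn_injective (hsucc.symm.trans hsucc')
      congr 1
      exact funext fun i => ih i (h' i)

theorem Denotes.isConsNode {G : Graph S} (hG : G.WellFormed) {v : G.V} {t : Tm ar}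
    (h : G.Denotes v t) {u : G.V} (hu : G.Reach v u) : G.IsConsNode u ∧ ∃ s, G.Denotes u s := by
  revert t
  induction hu using Relation.ReflTransGen.head_induction_on with
  | refl => intro t h; exact ⟨by cases h with | mk _ c _ _ hl => exact ⟨c, hl⟩, t, h⟩
  | head hab _ ih =>
    intro t h
    rename_i a b hb
    cases h with
    | mk _ c vs ts hl hs h =>
      rcases hab with hm | hm
      · simp [hG.nsucc_eq_nil hl] at hm
      · rw [hs, List.mem_ofFn] at hm
        obtain ⟨i, rfl⟩ := hm
        exact ih (h i)

end Graph

/-! ### Conditions on single rules -/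

/-- The weight of a label at the parameter `n`: the value at `n` of the polynomial attached to a
defined symbol, and `0` for constructors. -/
def labWeight (W : S.D → Polynomial ℕ) (n : ℕ) : Option S.Sym → ℕ
  | some (.inr d) => (W d).eval n
  | _ => 0

theorem labWeight_inr (W : S.D → Polynomial ℕ) (n : ℕ) (d : S.D) :
    labWeight W n (some (.inr d)) = (W d).eval n := rfl

/-- The nodes below the normal argument positions of `u`. -/
def Graph.belowNormal (G : Graph S) (u : G.V) : Set G.V := {v | ∃ a ∈ G.nsucc u, G.Reach a v}

/-- The requirements on a rule for the symbol `d`. Apart from shape conditions these are: `eval`,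
which says that both sides have the same value, and `weight`, by which the weight of
`d` exceeds the number plus the weights of the added nodes, provided that at most `n` terms are
represented at the normal arguments of `d`. -/
structure RuleOK (J : Interp S) (W : S.D → Polynomial ℕ) (d : S.D) (R : Rule S) : Prop where
  lab_l : R.graph.lab R.l = some (.inr d)
  cons : ∀ v, R.graph.Reach R.l v → v ≠ R.l → ∀ f, R.graph.lab v = some f → ∃ c : C, f = .inl c
  no_edge : ∀ v, ¬ R.graph.Edge v R.l
  new_lab : ∀ v, ¬ R.graph.Reach R.l v → R.graph.lab v ≠ none
  new_nsucc : ∀ v, ¬ R.graph.Reach R.l v → ∀ u ∈ R.graph.nsucc v, u ∈ R.graph.belowNormal R.l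
  eval : ∀ ε₀ : R.graph.V → Tm ar, (∀ v, R.graph.Reach R.l v → EvalAt J R.graph ε₀ v) →
    ∃ ε : R.graph.V → Tm ar, (∀ v, R.graph.Reach R.l v → ε v = ε₀ v) ∧
      (∀ v, ¬ R.graph.Reach R.l v → EvalAt J R.graph ε v) ∧ ε R.r = ε₀ R.l
  weight : ∀ ε₀ : R.graph.V → Tm ar, (∀ v, R.graph.Reach R.l v → EvalAt J R.graph ε₀ v) →
    ∀ n, (ε₀ '' R.graph.belowNormal R.l).ncard ≤ n →
      ∀ [Fintype {w : R.graph.V // ¬ R.graph.Reach R.l w}],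
        ∑ w : {w : R.graph.V // ¬ R.graph.Reach R.l w}, (1 + labWeight W n (R.graph.lab w.1)) + 1
          ≤ (W d).eval n

theorem RuleOK.isConstructor {J : Interp S} {W : S.D → Polynomial ℕ} {d : S.D} {R : Rule S}
    (h : RuleOK J W d R) : R.IsConstructor :=
  ⟨⟨d, h.lab_l⟩, fun v hv hne => h.cons v hv hne⟩

/-! ### Rewriting steps -/

section Extended

variable {G : Graph S} {R : Rule S} {φ : (R.graph.sub R.l).V → G.V}

theorem place_of_reach {w : R.graph.V} (h : R.graph.Reach R.l w) :
    place G R φ w = .inl (φ ⟨w, h⟩) := dif_pos h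

theorem place_of_not_reach {w : R.graph.V} (h : ¬ R.graph.Reach R.l w) :
    place G R φ w = .inr ⟨w, h⟩ := dif_neg h

/-- The image of the left root. -/
abbrev redexRoot (φ : (R.graph.sub R.l).V → G.V) : G.V := φ ⟨R.l, Relation.ReflTransGen.refl⟩

theorem place_l : place G R φ R.l = .inl (redexRoot φ) := place_of_reach _

theorem redirect_root : redirect G R φ (.inl (redexRoot φ)) = place G R φ R.r :=
  if_pos place_l.symm

theorem redirect_of_ne {p : G.V ⊕ {w : R.graph.V // ¬ R.graph.Reach R.l w}}
    (h : p ≠ .inl (redexRoot φ)) : redirect G R φ p = p :=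
  if_neg (by rwa [place_l])

variable (hφ : Graph.IsHom (R.graph.sub R.l) G φ) (hG : G.WellFormed)
include hφ hG

theorem place_ne_root {w : R.graph.V} (hw : w ≠ R.l) :
    place G R φ w ≠ .inl (redexRoot φ) := by
  by_cases h : R.graph.Reach R.l w
  · rw [place_of_reach h]
    exact fun he => hφ.ne_root R.wf hG h hw (Sum.inl_injective he)
  · rw [place_of_not_reach h]
    exact Sum.inr_ne_inl

theorem redirect_ne_root (p : G.V ⊕ {w : R.graph.V // ¬ R.graph.Reach R.l w}) :
    redirect G R φ p ≠ .inl (redexRoot φ) := by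
  by_cases h : p = .inl (redexRoot φ)
  · rw [h, redirect_root]; exact place_ne_root hφ hG R.ne.symm
  · rwa [redirect_of_ne h]

omit hφ hG in
theorem exists_redirect_of_reach {p q : (extended G R φ).V}
    (h : (extended G R φ).Reach (redirect G R φ p) q) : ∃ p', q = redirect G R φ p' := by
  rcases Relation.ReflTransGen.cases_tail h with h | ⟨b, -, hb⟩
  · exact ⟨p, h⟩
  · rcases b with b | b
    · rcases hb with hb | hb <;>
      · obtain ⟨u, -, rfl⟩ := List.mem_map.mp hb
        exact ⟨_, rfl⟩
    · rcases hb with hb | hb <;>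
      · obtain ⟨u, -, rfl⟩ := List.mem_map.mp hb
        exact ⟨_, rfl⟩

end Extended

/-- The result of a step embeds into the extended graph, with respect to all data. -/
theorem Step.exists_embedding {𝒢 : Set (Rule S)} {G H : TermGraph S} (h : Step 𝒢 G H) :
    ∃ R ∈ 𝒢, ∃ φ : (R.graph.sub R.l).V → G.V, Graph.IsHom (R.graph.sub R.l) G.toGraph φ ∧
      ∃ θ : H.V → (extended G.toGraph R φ).V, Function.Injective θ ∧
        θ H.root = redirect G.toGraph R φ (.inl G.root) ∧
        (∀ v, ∃ p, θ v = redirect G.toGraph R φ p) ∧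
        ∀ v, (extended G.toGraph R φ).lab (θ v) = H.lab v ∧
          (extended G.toGraph R φ).nsucc (θ v) = (H.nsucc v).map θ ∧
          (extended G.toGraph R φ).ssucc (θ v) = (H.ssucc v).map θ := by
  obtain ⟨R, hR, φ, hφ, ψ, hroot, hψ⟩ := h
  refine ⟨R, hR, φ, hφ, fun v => (ψ.symm v).1, Subtype.val_injective.comp ψ.symm.injective, ?_, ?_,
    ?_⟩
  · simp [← hroot]
  · exact fun v => exists_redirect_of_reach (ψ.symm v).2
  · intro v
    obtain ⟨u, rfl⟩ := ψ.surjective v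
    obtain ⟨h1, h2, h3⟩ := hψ u
    rw [h1, h2, h3]
    have hcomp : (fun v => (ψ.symm v).1) ∘ ψ = Subtype.val := funext fun v => by simp
    refine ⟨by simp, ?_, ?_⟩
    · rw [List.map_map, hcomp, Graph.sub_nsucc_map_val]
      simp
    · rw [List.map_map, hcomp, Graph.sub_ssucc_map_val]
      simp

/-- The invariant of rewriting. The set `M` collects the nodes that stem from the normal arguments
of the initial graph; these nodes carry constructors and are never changed, all normal arguments
lie among them, and they represent at most `n` terms. -/
structure Inv (J : Interp S) (G : Graph S) (ε : G.V → Tm ar) (M : Set G.V) (n : ℕ) : Prop where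
  lab : ∀ v, G.lab v ≠ none
  eval : ∀ v, EvalAt J G ε v
  closed : ∀ u ∈ M, ∀ v, G.Edge u v → v ∈ M
  cons : ∀ u ∈ M, G.IsConsNode u
  normal : ∀ u, ∀ v ∈ G.nsucc u, v ∈ M
  card : (ε '' M).ncard ≤ n

/-- Distinct nodes below a common node in `M` have distinct values. -/
def SharedOn (G : Graph S) (ε : G.V → Tm ar) (M : Set G.V) : Prop :=
  ∀ w ∈ M, Set.InjOn ε (G.below w)

theorem sum_le_sum_of_injective {α β : Type} [Fintype α] [Fintype β] {θ : α → β}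
    (hθ : Function.Injective θ) (g : β → ℕ) : ∑ a, g (θ a) ≤ ∑ b, g b := by
  classical
  rw [← Finset.sum_image (f := g) (fun a _ b _ h => hθ h)]
  exact Finset.sum_le_sum_of_subset (Finset.subset_univ _)

/-- The total of a function of the labels over all nodes. -/
def Graph.total (G : Graph S) (ω : Option S.Sym → ℕ) : ℕ := ∑ᶠ v, ω (G.lab v)

section Preservation

variable {J : Interp S} {W : S.D → Polynomial ℕ} {d : S.D} {R : Rule S} {G H : Graph S}
  {φ : (R.graph.sub R.l).V → G.V} {ε : G.V → Tm ar} {M : Set G.V} {n : ℕ}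

/-- The values at the left-hand side of a rule that are induced by a redex. -/
theorem exists_pullback_eval (hφ : Graph.IsHom (R.graph.sub R.l) G φ)
    (hε : ∀ v, EvalAt J G ε v) :
    ∃ ε₀ : R.graph.V → Tm ar, (∀ u (hu : R.graph.Reach R.l u), ε (φ ⟨u, hu⟩) = ε₀ u) ∧
      ∀ v, R.graph.Reach R.l v → EvalAt J R.graph ε₀ v := by
  classical
  let ε₀ : R.graph.V → Tm ar :=
    fun w => if h : R.graph.Reach R.l w then ε (φ ⟨w, h⟩) else ε (redexRoot φ)
  have hF : ∀ u (hu : R.graph.Reach R.l u), ε (φ ⟨u, hu⟩) = ε₀ u := fun u hu => by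
    simp only [ε₀, dif_pos hu]
  refine ⟨ε₀, hF, fun v hv s hs => ?_⟩
  rw [← hF v hv, hε _ s (hφ ⟨v, hv⟩ s hs).1, hφ.map_nsucc hv hs hF, hφ.map_ssucc hv hs hF]

theorem Inv.mem_of_belowNormal (hI : Inv J G ε M n) (hφ : Graph.IsHom (R.graph.sub R.l) G φ)
    {u : R.graph.V} (hu : u ∈ R.graph.belowNormal R.l) :
    ∃ h : R.graph.Reach R.l u, φ ⟨u, h⟩ ∈ M := by
  obtain ⟨a, ha, hau⟩ := hu
  have hla : R.graph.Reach R.l a := Relation.ReflTransGen.refl.tail (Or.inl ha)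
  refine ⟨hla.trans hau, ?_⟩
  exact Graph.Reach.mem_of_closed hI.closed
    (hI.normal _ _ (hφ.mem_nsucc R.wf Relation.ReflTransGen.refl ha)) (hφ.reach R.wf hla hau)

variable (hR : RuleOK J W d R) (hG : G.WellFormed) (hφ : Graph.IsHom (R.graph.sub R.l) G φ)
include hR hG hφ

omit hG in
theorem RuleOK.lab_redexRoot : G.lab (redexRoot φ) = some (.inr d) :=
  (hφ ⟨R.l, Relation.ReflTransGen.refl⟩ _ hR.lab_l).1

omit hG in
theorem Inv.redirect_of_mem (hI : Inv J G ε M n) {v : G.V} (hv : v ∈ M) :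
    redirect G R φ (.inl v) = .inl v := by
  refine redirect_of_ne fun h => ?_
  obtain ⟨c, hc⟩ := hI.cons v hv
  rw [Sum.inl_injective h, (hφ ⟨R.l, Relation.ReflTransGen.refl⟩ _ hR.lab_l).1] at hc
  simp at hc

omit hG in
/-- The invariant passes to the extended graph. -/
theorem Inv.extended (hI : Inv J G ε M n) : ∃ ε' : (extended G R φ).V → Tm ar,
    Inv J (extended G R φ) ε' (Sum.inl '' M) n ∧
    (∀ v, ε' (redirect G R φ (.inl v)) = ε v) ∧
    (SharedOn G ε M → SharedOn (GRS.extended G R φ) ε' (Sum.inl '' M)) := by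
  obtain ⟨ε₀, hε₀, hev⟩ := exists_pullback_eval hφ hI.eval
  obtain ⟨ε₁, hl, hn, hr⟩ := hR.eval ε₀ hev
  have hplace : ∀ w, Sum.elim ε (fun w : {w : R.graph.V // ¬ R.graph.Reach R.l w} => ε₁ w.1)
      (place G R φ w) = ε₁ w := by
    intro w
    by_cases hw : R.graph.Reach R.l w
    · rw [place_of_reach hw, Sum.elim_inl, hε₀, hl w hw]
    · rw [place_of_not_reach hw, Sum.elim_inr]
  -- redirection does not change values, since both roots of the rule have the same value
  have hred : ∀ p, Sum.elim ε (fun w : {w : R.graph.V // ¬ R.graph.Reach R.l w} => ε₁ w.1)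
      (redirect G R φ p) =
        Sum.elim ε (fun w : {w : R.graph.V // ¬ R.graph.Reach R.l w} => ε₁ w.1) p := by
    intro p
    by_cases hp : p = .inl (redexRoot φ)
    · rw [hp, redirect_root, hplace, hr, Sum.elim_inl]; exact (hε₀ _ _).symm
    · rw [redirect_of_ne hp]
  have hM : ∀ u ∈ M, ∀ q, (GRS.extended G R φ).Edge (.inl u) q → ∃ v, G.Edge u v ∧ q = .inl v := by
    rintro u hu q (h | h)
    · obtain ⟨v, hv, rfl⟩ := List.mem_map.mp h
      exact ⟨v, Or.inl hv, hI.redirect_of_mem hR hφ (hI.closed u hu v (Or.inl hv))⟩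
    · obtain ⟨v, hv, rfl⟩ := List.mem_map.mp h
      exact ⟨v, Or.inr hv, hI.redirect_of_mem hR hφ (hI.closed u hu v (Or.inr hv))⟩
  refine ⟨Sum.elim ε (fun w => ε₁ w.1), ⟨?_, ?_, ?_, ?_, ?_, ?_⟩, fun v => hred _, ?_⟩
  · rintro (v | w)
    · exact hI.lab v
    · exact hR.new_lab w.1 w.2
  · rintro (v | w) s hs
    · simp only [List.map_map, Function.comp_def, hred, Sum.elim_inl]
      exact hI.eval v s hs
    · simp only [List.map_map, Function.comp_def, hred, hplace, Sum.elim_inr]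
      exact hn w.1 w.2 s hs
  · rintro _ ⟨u, hu, rfl⟩ q hq
    obtain ⟨v, hv, rfl⟩ := hM u hu q hq
    exact ⟨v, hI.closed u hu v hv, rfl⟩
  · rintro _ ⟨u, hu, rfl⟩
    exact hI.cons u hu
  · rintro (v | w) q hq
    · obtain ⟨u, hu, rfl⟩ := List.mem_map.mp hq
      exact ⟨u, hI.normal v u hu, (hI.redirect_of_mem hR hφ (hI.normal v u hu)).symm⟩
    · obtain ⟨u, hu, rfl⟩ := List.mem_map.mp hq
      obtain ⟨hr, hm⟩ := hI.mem_of_belowNormal hφ (hR.new_nsucc w.1 w.2 u hu)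
      rw [place_of_reach hr, hI.redirect_of_mem hR hφ hm]
      exact ⟨_, hm, rfl⟩
  · rw [Set.image_image]
    exact hI.card
  · rintro hS _ ⟨w, hw, rfl⟩
    have hb : ∀ q, (GRS.extended G R φ).Reach (.inl w) q → ∃ v ∈ M, G.Reach w v ∧ q = .inl v := by
      intro q hq
      induction hq with
      | refl => exact ⟨w, hw, Relation.ReflTransGen.refl, rfl⟩
      | tail _ h ih =>
        obtain ⟨v, hv, hwv, rfl⟩ := ih
        obtain ⟨u, hu, rfl⟩ := hM v hv _ h
        exact ⟨u, hI.closed v hv u hu, hwv.tail hu, rfl⟩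
    intro p hp q hq hpq
    obtain ⟨a, -, ha, rfl⟩ := hb p hp
    obtain ⟨b, -, hb, rfl⟩ := hb q hq
    exact congrArg Sum.inl (hS w hw ha hb hpq)

omit hR hG hφ in
/-- The invariant passes to embedded graphs. -/
theorem Inv.of_embedding {M : Set G.V} (hI : Inv J G ε M n) (hfin : M.Finite) {θ : H.V → G.V}
    (hθ : Function.Injective θ)
    (h : ∀ v, G.lab (θ v) = H.lab v ∧ G.nsucc (θ v) = (H.nsucc v).map θ ∧
      G.ssucc (θ v) = (H.ssucc v).map θ) :
    Inv J H (ε ∘ θ) (θ ⁻¹' M) n ∧ (SharedOn G ε M → SharedOn H (ε ∘ θ) (θ ⁻¹' M)) := by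
  have hedge : ∀ u v, H.Edge u v → G.Edge (θ u) (θ v) := by
    rintro u v (hv | hv)
    · left; rw [(h u).2.1]; exact List.mem_map_of_mem hv
    · right; rw [(h u).2.2]; exact List.mem_map_of_mem hv
  have hreach : ∀ u v, H.Reach u v → G.Reach (θ u) (θ v) := fun _ _ h =>
    Relation.ReflTransGen.lift θ hedge _ _ h
  refine ⟨⟨?_, ?_, ?_, ?_, ?_, ?_⟩, ?_⟩
  · intro v
    rw [← (h v).1]
    exact hI.lab _
  · intro v s hs
    rw [← List.map_map, ← List.map_map, ← (h v).2.1, ← (h v).2.2]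
    exact hI.eval _ s ((h v).1.trans hs)
  · exact fun u hu v hv => hI.closed _ hu _ (hedge u v hv)
  · intro u hu
    obtain ⟨c, hc⟩ := hI.cons _ hu
    exact ⟨c, (h u).1.symm.trans hc⟩
  · intro u v hv
    refine hI.normal (θ u) _ ?_
    rw [(h u).2.1]
    exact List.mem_map_of_mem hv
  · refine (Set.ncard_le_ncard ?_ (hfin.image _)).trans hI.card
    rintro _ ⟨u, hu, rfl⟩
    exact ⟨θ u, hu, rfl⟩
  · intro hS w hw a ha b hb hab
    exact hθ (hS _ hw (hreach _ _ ha) (hreach _ _ hb) hab)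

/-- The effect of a step on the totals: the redex root disappears, and at most the added nodes
join. -/
theorem total_add_le (ω : Option S.Sym → ℕ) {θ : H.V → (extended G R φ).V}
    (hθ : Function.Injective θ) (hr : ∀ v, ∃ p, θ v = redirect G R φ p)
    (hl : ∀ v, (extended G R φ).lab (θ v) = H.lab v)
    [Fintype {w : R.graph.V // ¬ R.graph.Reach R.l w}] :
    H.total ω + ω (some (.inr d)) ≤ G.total ω +
      ∑ w : {w : R.graph.V // ¬ R.graph.Reach R.l w}, ω (R.graph.lab w.1) := by
  classical
  have := hG.finite
  have : Fintype G.V := Fintype.ofFinite _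
  have : Finite H.V := Finite.of_injective θ hθ
  have : Fintype H.V := Fintype.ofFinite _
  rw [Graph.total, Graph.total, finsum_eq_sum_of_fintype, finsum_eq_sum_of_fintype]
  -- no edge of the extended graph leads to the redex root, so that it is outside the range of `θ`
  have hinj : Function.Injective
      (fun o : Option H.V => o.elim (Sum.inl (redexRoot φ) : (extended G R φ).V) θ) := by
    have hne : ∀ v, θ v ≠ .inl (redexRoot φ) := fun v => by
      obtain ⟨p, hp⟩ := hr v
      rw [hp]; exact redirect_ne_root hφ hG p
    rintro (_ | a) (_ | b) hab
    · rfl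
    · exact absurd hab.symm (hne b)
    · exact absurd hab (hne a)
    · exact congrArg some (hθ hab)
  have h := sum_le_sum_of_injective hinj (fun p => ω ((extended G R φ).lab p))
  rw [Fintype.sum_option, Fintype.sum_sum_type] at h
  change ω (G.lab (redexRoot φ)) + ∑ v, ω ((extended G R φ).lab (θ v)) ≤ ∑ v, ω (G.lab v) +
    ∑ w : {w : R.graph.V // ¬ R.graph.Reach R.l w}, ω (R.graph.lab w.1) at h
  rw [hR.lab_redexRoot hφ, Fintype.sum_congr _ _ (fun v => congrArg ω (hl v))] at h
  omega

/-- The bound on the added nodes at a redex. -/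
theorem RuleOK.sum_le (hI : Inv J G ε M n) [Fintype {w : R.graph.V // ¬ R.graph.Reach R.l w}] :
    ∑ w : {w : R.graph.V // ¬ R.graph.Reach R.l w}, (1 + labWeight W n (R.graph.lab w.1)) + 1
      ≤ (W d).eval n := by
  obtain ⟨ε₀, hε₀, hev⟩ := exists_pullback_eval hφ hI.eval
  refine hR.weight ε₀ hev n ((Set.ncard_le_ncard ?_ ?_).trans hI.card)
  · rintro _ ⟨u, hu, rfl⟩
    obtain ⟨hr, hm⟩ := hI.mem_of_belowNormal hφ hu
    exact ⟨_, hm, hε₀ u hr⟩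
  · have := hG.finite
    exact (Set.toFinite M).image _

/-- The extended graph is well-formed. -/
theorem extended_wellFormed : (extended G R φ).WellFormed where
  finite := by
    have := hG.finite
    have := R.wf.finite
    exact inferInstanceAs (Finite (G.V ⊕ {w : R.graph.V // ¬ R.graph.Reach R.l w}))
  nlen := by
    rintro (v | w) f hf
    · simpa using hG.nlen v f hf
    · simpa using R.wf.nlen w.1 f hf
  slen := by
    rintro (v | w) f hf
    · simpa using hG.slen v f hf
    · simpa using R.wf.slen w.1 f hf
  unlabeled := by
    rintro (v | w) hn
    · simpa using hG.unlabeled v hn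
    · simpa using R.wf.unlabeled w.1 hn
  acyclic := by
    classical
    obtain ⟨ρ, hρ⟩ := G.exists_rank hG.finite hG.acyclic
    obtain ⟨σ, hσ⟩ := R.graph.exists_rank R.wf.finite R.wf.acyclic
    have := hG.finite
    have := R.wf.finite
    obtain ⟨a, ha⟩ := (Set.finite_range ρ).bddAbove
    obtain ⟨b, hb⟩ := (Set.finite_range σ).bddAbove
    replace ha : ∀ v, ρ v ≤ a := fun v => ha ⟨v, rfl⟩
    replace hb : ∀ v, σ v ≤ b := fun v => hb ⟨v, rfl⟩
    -- The nodes that do not lead to the redex come first, then the added nodes, then the nodes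
    -- that lead to the redex.
    let τ : (extended G R φ).V → ℕ := Sum.elim
      (fun v => if G.Reach v (redexRoot φ) then a + b + 2 + ρ v else ρ v)
      (fun w => a + 1 + σ w.1)
    have hbelow : ∀ w (hw : R.graph.Reach R.l w), w ≠ R.l →
        ¬ G.Reach (φ ⟨w, hw⟩) (redexRoot φ) := by
      intro w hw hne h
      rcases Relation.reflTransGen_iff_eq_or_transGen.mp
        (hφ.reach R.wf Relation.ReflTransGen.refl hw) with h' | h'
      · exact hφ.ne_root R.wf hG hw hne h'
      · exact hG.acyclic _ (h'.trans_left h)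
    have hplace : ∀ w, w ≠ R.l → τ (place G R φ w) ≤ a + b + 1 := by
      intro w hne
      by_cases hw : R.graph.Reach R.l w
      · have := ha (φ ⟨w, hw⟩)
        simp only [τ, place_of_reach hw, Sum.elim_inl, if_neg (hbelow w hw hne)]
        omega
      · have := hb w
        simp only [τ, place_of_not_reach hw, Sum.elim_inr]
        omega
    have hinl : ∀ u v, G.Edge u v → τ (redirect G R φ (.inl v)) < τ (.inl u) := by
      intro u v huv
      have h1 := hρ u v huv
      by_cases hv : v = redexRoot φ
      · subst hv
        rw [redirect_root]
        have h2 := hplace R.r R.ne.symm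
        have h3 : τ (.inl u) = a + b + 2 + ρ u := if_pos (Relation.ReflTransGen.single huv)
        omega
      · rw [redirect_of_ne (fun h => hv (Sum.inl_injective h))]
        simp only [τ, Sum.elim_inl]
        by_cases h : G.Reach v (redexRoot φ)
        · rw [if_pos h, if_pos (show G.Reach u _ from Relation.ReflTransGen.head huv h)]
          omega
        · rw [if_neg h]
          split <;> omega
    have hinr : ∀ (w : {w : R.graph.V // ¬ R.graph.Reach R.l w}) u, R.graph.Edge w.1 u →
        τ (redirect G R φ (place G R φ u)) < τ (.inr w) := by
      intro w u hwu
      have hu : u ≠ R.l := fun h => hR.no_edge _ (h ▸ hwu)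
      rw [redirect_of_ne (place_ne_root hφ hG hu)]
      by_cases hr : R.graph.Reach R.l u
      · have := ha (φ ⟨u, hr⟩)
        simp only [τ, place_of_reach hr, Sum.elim_inl, if_neg (hbelow u hr hu), Sum.elim_inr]
        omega
      · have := hσ _ _ hwu
        simp only [τ, place_of_not_reach hr, Sum.elim_inr]
        omega
    refine Graph.acyclic_of_rank τ ?_
    rintro (u | w) q (h | h)
    · obtain ⟨v, hv, rfl⟩ := List.mem_map.mp h
      exact hinl u v (Or.inl hv)
    · obtain ⟨v, hv, rfl⟩ := List.mem_map.mp h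
      exact hinl u v (Or.inr hv)
    · obtain ⟨v, hv, rfl⟩ := List.mem_map.mp h
      exact hinr w v (Or.inl hv)
    · obtain ⟨v, hv, rfl⟩ := List.mem_map.mp h
      exact hinr w v (Or.inr hv)

end Preservation

/-- Every redex can be contracted. -/
theorem exists_step {J : Interp S} {W : S.D → Polynomial ℕ} {d : S.D} {𝒢 : Set (Rule S)}
    {R : Rule S} (hR : RuleOK J W d R) (hmem : R ∈ 𝒢) (G : TermGraph S)
    {φ : (R.graph.sub R.l).V → G.V} (hφ : Graph.IsHom (R.graph.sub R.l) G.toGraph φ) :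
    ∃ H, Step 𝒢 G H := by
  refine ⟨⟨(extended G.toGraph R φ).sub (redirect G.toGraph R φ (.inl G.root)),
    (extended_wellFormed hR G.wf hφ).sub _, ⟨_, Relation.ReflTransGen.refl⟩,
    Graph.sub_reach _ _⟩, R, hmem, φ, hφ, Equiv.refl _, rfl, fun v => ⟨rfl, ?_, ?_⟩⟩ <;> simp

/-! ### Systems that implement an interpretation -/

/-- The rules `ℛ` for the symbol `d` apply to every node with label `d` whose arguments are
constructor graphs, the normal ones with maximal sharing. -/
def Progress (J : Interp S) (d : S.D) (ℛ : Set (Rule S)) : Prop :=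
  ∀ (G : Graph S) (ε : G.V → Tm ar) (u : G.V), G.WellFormed → (∀ v, EvalAt J G ε v) →
    G.lab u = some (.inr d) → (∀ v, G.Edge u v → ∀ w, G.Reach v w → G.IsConsNode w) →
    (∀ a ∈ G.nsucc u, Set.InjOn ε (G.below a)) →
    ∃ R ∈ ℛ, ∃ φ : (R.graph.sub R.l).V → G.V,
      Graph.IsHom (R.graph.sub R.l) G φ ∧ redexRoot φ = u

/-- A symbol is implementable if it has a set of rules, of one of the permitted kinds, that are
correct, decrease the weights, and suffice for evaluation. -/
def Implementable (J : Interp S) (W : S.D → Polynomial ℕ) (d : S.D) : Prop :=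
  ∃ ℛ : Set (Rule S), (∀ R ∈ ℛ, RuleOK J W d R) ∧ Progress J d ℛ ∧
    ((∀ R ∈ ℛ, Nonempty (SafeUnfolding R)) ∨
      (ℛ.Finite ∧ ∀ R ∈ ℛ, R.IsSubgraphRule ∨ Nonempty (SafeComposition R)))

section System

variable {J : Interp S} {W : S.D → Polynomial ℕ} {𝒢 : Set (Rule S)}

theorem Step.inv (h𝒢 : ∀ R ∈ 𝒢, ∃ d, RuleOK J W d R) {G H : TermGraph S} (h : Step 𝒢 G H)
    {ε : G.V → Tm ar} {M : Set G.V} {n : ℕ} (hI : Inv J G.toGraph ε M n) :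
    ∃ (ε' : H.V → Tm ar) (M' : Set H.V), Inv J H.toGraph ε' M' n ∧ ε' H.root = ε G.root ∧
      (SharedOn G.toGraph ε M → SharedOn H.toGraph ε' M') ∧
      H.total (labWeight W n) + 1 ≤ G.total (labWeight W n) ∧
      H.total (fun s => 1 + labWeight W n s) ≤ G.total (fun s => 1 + labWeight W n s) := by
  obtain ⟨R, hR, φ, hφ, θ, hθ, hroot, hred, hall⟩ := h.exists_embedding
  obtain ⟨d, hR⟩ := h𝒢 R hR
  obtain ⟨ε₁, hI₁, hε₁, hS₁⟩ := hI.extended hR hφ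
  have hfin := G.wf.finite
  have := R.wf.finite
  have : Fintype {w : R.graph.V // ¬ R.graph.Reach R.l w} := Fintype.ofFinite _
  obtain ⟨hI₂, hS₂⟩ := hI₁.of_embedding ((Set.toFinite M).image _) hθ hall
  refine ⟨_, _, hI₂, ?_, fun h => hS₂ (hS₁ h), ?_, ?_⟩
  · rw [Function.comp_apply, hroot, hε₁]
  · have h1 := total_add_le hR G.wf hφ (labWeight W n) hθ hred (fun v => (hall v).1)
    have h2 := hR.sum_le G.wf hφ hI
    rw [Finset.sum_add_distrib] at h2
    rw [labWeight_inr] at h1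
    omega
  · have h1 := total_add_le hR G.wf hφ (fun s => 1 + labWeight W n s) hθ hred
      (fun v => (hall v).1)
    have h2 := hR.sum_le G.wf hφ hI
    rw [labWeight_inr] at h1
    omega

theorem Steps.inv (h𝒢 : ∀ R ∈ 𝒢, ∃ d, RuleOK J W d R) {m : ℕ} {G H : TermGraph S}
    (h : Steps 𝒢 m G H) {ε : G.V → Tm ar} {M : Set G.V} {n : ℕ} (hI : Inv J G.toGraph ε M n) :
    ∃ (ε' : H.V → Tm ar) (M' : Set H.V), Inv J H.toGraph ε' M' n ∧ ε' H.root = ε G.root ∧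
      (SharedOn G.toGraph ε M → SharedOn H.toGraph ε' M') ∧
      H.total (labWeight W n) + m ≤ G.total (labWeight W n) ∧
      H.total (fun s => 1 + labWeight W n s) ≤ G.total (fun s => 1 + labWeight W n s) := by
  induction h with
  | zero => exact ⟨ε, M, hI, rfl, id, le_rfl, le_rfl⟩
  | succ _ hs ih =>
    obtain ⟨ε₁, M₁, hI₁, h1, h2, h3, h4⟩ := ih hI
    obtain ⟨ε₂, M₂, hI₂, h1', h2', h3', h4'⟩ := hs.inv h𝒢 hI₁
    exact ⟨ε₂, M₂, hI₂, h1'.trans h1, fun h => h2' (h2 h), by omega, h4'.trans h4⟩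

/-- A normal form represents the value of its root. -/
theorem NormalForm.denotes
    (hprog : ∀ d, ∃ ℛ ⊆ 𝒢, (∀ R ∈ ℛ, RuleOK J W d R) ∧ Progress J d ℛ)
    {G : TermGraph S} (hnf : NormalForm 𝒢 G) {ε : G.V → Tm ar} {M : Set G.V} {n : ℕ}
    (hI : Inv J G.toGraph ε M n) (hS : SharedOn G.toGraph ε M) :
    G.toGraph.Denotes G.root (ε G.root) := by
  obtain ⟨ρ, hρ⟩ := G.exists_rank G.wf.finite G.wf.acyclic
  have hcons : ∀ N u, ρ u = N → G.toGraph.IsConsNode u := by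
    intro N
    induction N using Nat.strong_induction_on with
    | _ N ih =>
      intro u hu
      obtain ⟨s, hs⟩ := Option.ne_none_iff_exists'.mp (hI.lab u)
      rcases s with c | d
      · exact ⟨c, hs⟩
      exfalso
      obtain ⟨ℛ, hsub, hok, hp⟩ := hprog d
      obtain ⟨R, hR, φ, hφ, -⟩ := hp G.toGraph ε u G.wf hI.eval hs (fun v huv w hvw =>
        ih (ρ w) (by
          rcases Relation.reflTransGen_iff_eq_or_transGen.mp hvw with h | h
          · rw [h, ← hu]; exact hρ _ _ huv
          · rw [← hu]; exact (Graph.rank_lt_of_transGen hρ h).trans (hρ _ _ huv)) w rfl)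
        (fun a ha => hS a (hI.normal u a ha))
      obtain ⟨H, hH⟩ := exists_step (hok R hR) (hsub hR) G hφ
      exact hnf H hH
  obtain ⟨t, ht⟩ := Graph.exists_denotes G.wf G.root (fun u _ => hcons _ u rfl)
  rwa [ht.eval G.wf hI.eval]

/-- Evaluation terminates with a normal form. -/
theorem exists_normalForm (h𝒢 : ∀ R ∈ 𝒢, ∃ d, RuleOK J W d R) {G : TermGraph S}
    {ε : G.V → Tm ar} {M : Set G.V} {n : ℕ} (hI : Inv J G.toGraph ε M n) :
    ∃ m H, Steps 𝒢 m G H ∧ NormalForm 𝒢 H := by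
  by_contra! hcon
  have h : ∀ m, ∃ H, Steps 𝒢 m G H := by
    intro m
    induction m with
    | zero => exact ⟨G, .zero G⟩
    | succ m ih =>
      obtain ⟨H, hH⟩ := ih
      have h := hcon m H hH
      simp only [NormalForm, not_forall, not_not] at h
      obtain ⟨K, hK⟩ := h
      exact ⟨K, .succ hH hK⟩
  obtain ⟨H, hH⟩ := h (G.total (labWeight W n) + 1)
  obtain ⟨-, -, -, -, -, h, -⟩ := hH.inv h𝒢 hI
  omega

/-- A graph whose root is its only node with a defined symbol satisfies the invariant, with the
nodes below its normal arguments for `M`. -/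
theorem exists_inv (J : Interp S) {G : TermGraph S} {d : S.D}
    (hroot : G.lab G.root = some (.inr d))
    (hcons : ∀ v, G.Edge G.root v → ∀ u, G.toGraph.Reach v u → G.toGraph.IsConsNode u) :
    ∃ ε : G.V → Tm ar, Inv J G.toGraph ε G.normalPart G.normalPart.ncard ∧
      ∀ v t, G.toGraph.Denotes v t → ε v = t := by
  classical
  have hfin := G.wf.finite
  have hne : ∀ v, v ≠ G.root → ∀ u, G.toGraph.Reach v u → G.toGraph.IsConsNode u := by
    intro v hv u hu
    rcases Relation.ReflTransGen.cases_head (G.reach v) with h | ⟨b, hb, hbv⟩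
    · exact absurd h.symm hv
    · exact hcons b hb u (hbv.trans hu)
  have hnr : ∀ u v, G.Edge u v → v ≠ G.root := fun u v huv h =>
    G.wf.acyclic _ (Relation.TransGen.tail' (G.reach u) (h ▸ huv))
  have : Nonempty (Tm ar) := ⟨J.val (.inr d) [] []⟩
  choose! δ hδ using fun v (hv : v ≠ G.root) => Graph.exists_denotes G.wf v (hne v hv)
  let ε : G.V → Tm ar := fun v => if v = G.root then
    J.val (.inr d) ((G.nsucc G.root).map δ) ((G.ssucc G.root).map δ) else δ v
  have hεδ : ∀ v, v ≠ G.root → ε v = δ v := fun v hv => if_neg hv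
  have hn : ∀ u, (G.nsucc u).map ε = (G.nsucc u).map δ := fun u =>
    List.map_congr_left fun v hv => hεδ v (hnr u v (Or.inl hv))
  have hs : ∀ u, (G.ssucc u).map ε = (G.ssucc u).map δ := fun u =>
    List.map_congr_left fun v hv => hεδ v (hnr u v (Or.inr hv))
  have hmem : ∀ {u}, u ∈ G.normalPart ↔ ∃ a ∈ G.nsucc G.root, G.toGraph.Reach a u := by
    intro u
    simp [TermGraph.normalPart, Graph.below]
  have hMne : ∀ u ∈ G.normalPart, u ≠ G.root := by
    rintro u hu rfl
    obtain ⟨a, ha, hau⟩ := hmem.mp hu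
    exact G.wf.acyclic _ (Relation.TransGen.head' (Or.inl ha) hau)
  refine ⟨ε, ⟨?_, ?_, ?_, ?_, ?_, ?_⟩, ?_⟩
  · intro v
    by_cases hv : v = G.root
    · rw [hv, hroot]; simp
    · obtain ⟨c, hc⟩ := hne v hv v Relation.ReflTransGen.refl
      rw [hc]; simp
  · intro v s hl
    rw [hn, hs]
    by_cases hv : v = G.root
    · subst hv
      obtain rfl : s = .inr d := by simpa [hroot] using hl.symm
      exact if_pos rfl
    · rw [hεδ v hv]
      generalize ht : δ v = t
      have hd := hδ v hv
      rw [ht] at hd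
      cases hd with
      | mk _ c vs ts hlab hsucc h =>
        obtain rfl : s = .inl c := by simpa [hlab] using hl.symm
        rw [G.wf.nsucc_eq_nil hlab, hsucc, List.map_nil, List.map_ofFn, J.val_constr]
        congr 1
        funext i
        exact (h i).unique (hδ _ (hnr v _ (Or.inr (by simp [hsucc]))))
  · intro u hu v huv
    obtain ⟨a, ha, hau⟩ := hmem.mp hu
    exact hmem.mpr ⟨a, ha, hau.tail huv⟩
  · intro u hu
    exact hne u (hMne u hu) u Relation.ReflTransGen.refl
  · intro u v hv
    by_cases hu : u = G.root
    · subst hu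
      exact hmem.mpr ⟨v, hv, Relation.ReflTransGen.refl⟩
    · obtain ⟨c, hc⟩ := hne u hu u Relation.ReflTransGen.refl
      rw [G.wf.nsucc_eq_nil hc] at hv
      simp at hv
  · exact Set.ncard_image_le (Set.toFinite _)
  · intro v t ht
    have hv : v ≠ G.root := by
      rintro rfl
      cases ht with
      | mk _ c _ _ hl => simp [hroot] at hl
    rw [hεδ v hv]
    exact (hδ v hv).unique ht

end System

section Assembly

variable {J : Interp S} {W : S.D → Polynomial ℕ}

/-- Initially only the root contributes to the total weight. -/
theorem total_labWeight {G : TermGraph S} {d : S.D} (hroot : G.lab G.root = some (.inr d))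
    (hcons : ∀ v, G.Edge G.root v → ∀ u, G.toGraph.Reach v u → G.toGraph.IsConsNode u) (n : ℕ) :
    G.total (labWeight W n) = (W d).eval n := by
  have := G.wf.finite
  have : Fintype G.V := Fintype.ofFinite _
  rw [Graph.total, finsum_eq_sum_of_fintype, Fintype.sum_eq_single G.root, hroot, labWeight_inr]
  intro v hv
  rcases Relation.ReflTransGen.cases_head (G.reach v) with h | ⟨b, hb, hbv⟩
  · exact absurd h.symm hv
  · obtain ⟨c, hc⟩ := hcons b hb v hbv
    rw [hc]
    rfl

theorem total_one_add (G : TermGraph S) (ω : Option S.Sym → ℕ) :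
    G.total (fun s => 1 + ω s) = G.size + G.total ω := by
  have := G.wf.finite
  have : Fintype G.V := Fintype.ofFinite _
  rw [Graph.total, Graph.total, finsum_eq_sum_of_fintype, finsum_eq_sum_of_fintype,
    Finset.sum_add_distrib, TermGraph.size, Nat.card_eq_fintype_card]
  simp

/-- If all symbols are implementable, then the union of their rules is a system with the required
properties, and it defines the interpretation of each symbol. -/
theorem exists_system (hW : ∀ d, Implementable J W d) {k l : ℕ} (d₀ : S.D)
    (hk : S.normal d₀ = k) (hl : S.safe d₀ = l)
    {f : (Fin k → Tm ar) → (Fin l → Tm ar) → Tm ar}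
    (hf : ∀ x y, J.val (.inr d₀) (List.ofFn x) (List.ofFn y) = f x y) :
    ∃ (𝒢 : Set (Rule S)) (p : Polynomial ℕ),
      IsConstructorSystem 𝒢 ∧ IsSafeRecursive 𝒢 ∧ Defines 𝒢 f ∧
      ∀ (G H : TermGraph S) (m : ℕ), G.Closed → G.Basic → Steps 𝒢 m G H →
        m ≤ p.eval G.normalPart.ncard ∧
        H.size ≤ p.eval G.normalPart.ncard + (G.normalPartᶜ).ncard := by
  have hD := S.finite_D
  have : Fintype S.D := Fintype.ofFinite _
  choose ℛ hok hprog hshape using hW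
  have h𝒢 : ∀ R ∈ ⋃ d, ℛ d, ∃ d, RuleOK J W d R := by
    intro R hR
    obtain ⟨d, hd⟩ := Set.mem_iUnion.mp hR
    exact ⟨d, hok d R hd⟩
  refine ⟨⋃ d, ℛ d, Polynomial.X + ∑ d, W d, ?_, ?_, ?_, ?_⟩
  · intro R hR
    obtain ⟨d, hd⟩ := h𝒢 R hR
    exact hd.isConstructor
  · refine ⟨⋃ d ∈ {d | ∀ R ∈ ℛ d, Nonempty (SafeUnfolding R)}, ℛ d,
      ⋃ d ∈ {d | ¬ ∀ R ∈ ℛ d, Nonempty (SafeUnfolding R)}, ℛ d, ?_, ?_, ?_, ?_⟩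
    · ext R
      simp only [Set.mem_iUnion, Set.mem_union, Set.mem_ofPred_eq, exists_prop]
      constructor
      · rintro ⟨d, hd⟩
        by_cases h : ∀ R ∈ ℛ d, Nonempty (SafeUnfolding R)
        · exact Or.inl ⟨d, h, hd⟩
        · exact Or.inr ⟨d, h, hd⟩
      · rintro (⟨d, -, hd⟩ | ⟨d, -, hd⟩) <;> exact ⟨d, hd⟩
    · intro R hR
      simp only [Set.mem_iUnion, Set.mem_ofPred_eq, exists_prop] at hR
      obtain ⟨d, h, hd⟩ := hR
      exact h R hd
    · exact Set.Finite.biUnion (Set.toFinite _) fun d hd => ((hshape d).resolve_left hd).1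
    · intro R hR
      simp only [Set.mem_iUnion, Set.mem_ofPred_eq, exists_prop] at hR
      obtain ⟨d, h, hd⟩ := hR
      exact ((hshape d).resolve_left h).2 R hd
  · refine ⟨d₀, hk, hl, fun G v w x y hroot hns hss hv hw => ?_⟩
    have hcons : ∀ a, G.Edge G.root a → ∀ u, G.toGraph.Reach a u → G.toGraph.IsConsNode u := by
      rintro a (ha | ha) u hu
      · rw [hns, List.mem_ofFn] at ha
        obtain ⟨i, rfl⟩ := ha
        exact ((hv i).isConsNode G.wf hu).1
      · rw [hss, List.mem_ofFn] at ha
        obtain ⟨i, rfl⟩ := ha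
        exact ((hw i).isConsNode G.wf hu).1
    obtain ⟨ε, hI, hε⟩ := exists_inv J hroot hcons
    have hval : ε G.root = f x y := by
      rw [hI.eval G.root _ hroot, hns, hss, List.map_ofFn, List.map_ofFn, ← hf]
      congr 2
      · exact funext fun i => hε _ _ (hv i)
      · exact funext fun i => hε _ _ (hw i)
    refine ⟨fun m H t hs ht => ?_, fun hshared => ?_⟩
    · obtain ⟨ε', M', hI', hr, -⟩ := hs.inv h𝒢 hI
      rw [← ht.eval H.wf hI'.eval, hr, hval]
    have hS : SharedOn G.toGraph ε G.normalPart := by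
      intro u hu a ha b hb hab
      simp only [TermGraph.normalPart, Set.mem_iUnion, Set.mem_ofPred_eq, exists_prop] at hu
      obtain ⟨c, hc, hcu⟩ := hu
      rw [hns, List.mem_ofFn] at hc
      obtain ⟨i, rfl⟩ := hc
      obtain ⟨-, s, hs⟩ := (hv i).isConsNode G.wf (hcu.trans ha)
      obtain ⟨-, t, ht⟩ := (hv i).isConsNode G.wf (hcu.trans hb)
      obtain rfl : s = t := by rw [← hε a s hs, ← hε b t ht, hab]
      exact hshared i a (hcu.trans ha) b (hcu.trans hb) s hs ht
    have hnf : ∀ m H, Steps (⋃ d, ℛ d) m G H → NormalForm (⋃ d, ℛ d) H →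
        H.toGraph.Denotes H.root (f x y) := by
      intro m H hs hH
      obtain ⟨ε', M', hI', hr, hS', -⟩ := hs.inv h𝒢 hI
      have h := hH.denotes (fun d => ⟨ℛ d, Set.subset_iUnion _ d, hok d, hprog d⟩) hI' (hS' hS)
      rwa [hr, hval] at h
    obtain ⟨m, H, hs, hH⟩ := exists_normalForm h𝒢 hI
    exact ⟨⟨m, H, hs, hnf m H hs hH⟩, hnf⟩
  · intro G H m hclosed hbasic hs
    obtain ⟨⟨d, hroot⟩, hb⟩ := hbasic
    have hcons : ∀ v, G.Edge G.root v → ∀ u, G.toGraph.Reach v u → G.toGraph.IsConsNode u := by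
      intro v hv u hu
      obtain ⟨s, hs⟩ := Option.ne_none_iff_exists'.mp (hclosed u)
      obtain ⟨c, rfl⟩ := hb v hv u hu s hs
      exact ⟨c, hs⟩
    obtain ⟨ε, hI, -⟩ := exists_inv J hroot hcons
    obtain ⟨ε', M', -, -, -, h1, h2⟩ := hs.inv h𝒢 hI
    rw [total_one_add, total_one_add] at h2
    rw [total_labWeight hroot hcons] at h1 h2
    have hfin := G.wf.finite
    have hcard := Set.ncard_add_ncard_compl G.normalPart
    have hle : (W d).eval G.normalPart.ncard ≤ ∑ d, (W d).eval G.normalPart.ncard :=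
      Finset.single_le_sum (f := fun d => (W d).eval G.normalPart.ncard) (fun _ _ => Nat.zero_le _)
        (Finset.mem_univ d)
    rw [Polynomial.eval_add, Polynomial.eval_X, Polynomial.eval_finsetSum]
    simp only [TermGraph.size] at h2 ⊢
    omega

end Assembly

/-! ### Auxiliary facts on rules and redexes -/

/-- A colouring of the nodes into normal and safe ones witnesses argument separation. -/
theorem Graph.separated_of_coloring {G : Graph S} (κ : G.V → Prop)
    (hn : ∀ u, G.IsDefNode u → ∀ v ∈ G.nsucc u, κ v)
    (hs : ∀ u, G.IsDefNode u → ∀ v ∈ G.ssucc u, ¬ κ v)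
    (hc : ∀ u v, G.IsConsNode u → G.Edge u v → (κ u ↔ κ v)) (a : G.V) : G.Separated a := by
  have hpath : ∀ u v, G.ConsPath u v → (κ u ↔ κ v) := by
    intro u v h
    induction h with
    | refl => rfl
    | tail _ h ih => exact ih.trans (hc _ _ h.1 h.2)
  intro v _
  by_cases hv : κ v
  · exact Or.inl fun u _ hu s hsu h => hs u hu s hsu ((hpath s v h).mpr hv)
  · exact Or.inr fun u _ hu s hsu h => hv ((hpath s v h).mp (hn u hu s hsu))

theorem Graph.isHom_comp_val {G H : Graph S} {a : G.V} (ψ : G.V → H.V)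
    (h : ∀ v, G.Reach a v → ∀ s, G.lab v = some s → H.lab (ψ v) = some s ∧
      H.nsucc (ψ v) = (G.nsucc v).map ψ ∧ H.ssucc (ψ v) = (G.ssucc v).map ψ) :
    Graph.IsHom (G.sub a) H (fun v => ψ v.1) := by
  intro v s hs
  obtain ⟨h1, h2, h3⟩ := h v.1 v.2 s hs
  refine ⟨h1, ?_, ?_⟩
  · rw [h2, ← sub_nsucc_map_val, List.map_map]; rfl
  · rw [h3, ← sub_ssucc_map_val, List.map_map]; rfl

theorem eq_ofFn_getD {α : Type} (xs : List α) (a : α) {n : ℕ} (h : xs.length = n) :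
    xs = List.ofFn fun i : Fin n => xs.getD i a := by
  subst h
  apply List.ext_getElem <;> simp

theorem exists_eq_ofFn {α : Type} {xs : List α} {n : ℕ} (h : xs.length = n) :
    ∃ f : Fin n → α, xs = List.ofFn f := by
  subst h
  exact ⟨xs.get, (List.ofFn_get xs).symm⟩

theorem sum_not_reach_le {V ι : Type} [Fintype ι] {P : V → Prop} [Fintype {w : V // P w}]
    (T : ι → V) (hT : ∀ w, P w → ∃ i, T i = w) (g : V → ℕ) :
    ∑ w : {w : V // P w}, g w.1 ≤ ∑ i, g (T i) := by
  choose i hi using fun w : {w : V // P w} => hT w.1 w.2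
  have hinj : Function.Injective i := fun a b h =>
    Subtype.ext (by rw [← hi a, ← hi b, h])
  calc ∑ w : {w : V // P w}, g w.1 = ∑ w : {w : V // P w}, g (T (i w)) := by simp [hi]
    _ ≤ _ := sum_le_sum_of_injective hinj fun j => g (T j)

/-! ### Rules that select a subgraph -/

/-- The nodes of a left-hand side `d(x ; p)` whose safe arguments are patterns of depth at most
one: `w i` is the number of arguments of the `i`-th pattern. -/
inductive PatNode (k : ℕ) {l : ℕ} (w : Fin l → ℕ) : Type
  | root : PatNode k w
  | normal (i : Fin k) : PatNode k w
  | safe (i : Fin l) : PatNode k w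
  | sub (i : Fin l) (j : Fin (w i)) : PatNode k w

instance PatNode.finite (k : ℕ) {l : ℕ} (w : Fin l → ℕ) : Finite (PatNode k w) := by
  refine Finite.of_injective (β := Unit ⊕ Fin k ⊕ Fin l ⊕ Σ i, Fin (w i)) (fun
    | .root => .inl ()
    | .normal i => .inr (.inl i)
    | .safe i => .inr (.inr (.inl i))
    | .sub i j => .inr (.inr (.inr ⟨i, j⟩))) ?_
  rintro (_ | _ | _ | _) (_ | _ | _ | _) h <;> simp_all

/-- The number of arguments of a pattern, which is a variable or a constructor applied to
variables. -/
abbrev patArity {l : ℕ} (pat : Fin l → Option C) (ar : C → ℕ) (i : Fin l) : ℕ := (pat i).elim 0 ar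

/-- The left-hand side `d(x ; p)`. -/
abbrev patGraph (d : S.D) (k : ℕ) {l : ℕ} (pat : Fin l → Option C) : Graph S where
  V := PatNode k (patArity pat ar)
  lab
    | .root => some (.inr d)
    | .safe i => (pat i).map Sum.inl
    | _ => none
  nsucc
    | .root => List.ofFn PatNode.normal
    | _ => []
  ssucc
    | .root => List.ofFn PatNode.safe
    | .safe i => List.ofFn (PatNode.sub i)
    | _ => []

section Pattern

variable {d : S.D} {k l : ℕ} (hk : S.normal d = k) (hl : S.safe d = l) (pat : Fin l → Option C)

theorem patGraph_reach (v : PatNode k (patArity pat ar)) :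
    (patGraph d k pat).Reach .root v := by
  have hs : ∀ i, (patGraph d k pat).Reach .root (.safe i) := fun i =>
    Relation.ReflTransGen.single (Or.inr (by simp))
  rcases v with _ | i | i | ⟨i, j⟩
  · exact Relation.ReflTransGen.refl
  · exact Relation.ReflTransGen.single (Or.inl (by simp))
  · exact hs i
  · exact (hs i).tail (Or.inr (by simp))

theorem patGraph_separated (a : PatNode k (patArity pat ar)) :
    (patGraph d k pat).Separated a := by
  refine Graph.separated_of_coloring (G := patGraph d k pat)
    (fun v => match v with | .normal _ => True | _ => False) ?_ ?_ ?_ a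
  · rintro (_ | i | i | ⟨i, j⟩) - v hv <;> simp at hv
    obtain ⟨i, rfl⟩ := hv
    trivial
  · rintro (_ | i | i | ⟨i, j⟩) hd v hv <;> simp at hv
    · obtain ⟨i, rfl⟩ := hv
      exact id
    · obtain ⟨i, rfl⟩ := hv
      exact id
  · rintro (_ | i | i | ⟨i, j⟩) v ⟨c, hc⟩ (hv | hv) <;> simp at hc hv
    obtain ⟨i, rfl⟩ := hv
    rfl

include hk hl in
theorem patGraph_wellFormed : (patGraph d k pat).WellFormed where
  finite := inferInstanceAs (Finite (PatNode k (patArity pat ar)))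
  nlen := by
    rintro (_ | i | i | ⟨i, j⟩) f hf <;> simp at hf
    · subst hf; simp [Signature.nar, hk]
    · obtain ⟨c, hc, rfl⟩ := hf; simp [Signature.nar]
  slen := by
    rintro (_ | i | i | ⟨i, j⟩) f hf <;> simp at hf
    · subst hf; simp [Signature.sar, hl]
    · obtain ⟨c, hc, rfl⟩ := hf; simp [Signature.sar, patArity, hc]
  unlabeled := by
    rintro (_ | i | i | ⟨i, j⟩) hf <;> simp at hf
    · simp
    · simp [patArity, hf]
    · simp
  acyclic := by
    refine Graph.acyclic_of_rank (G := patGraph d k pat)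
      (fun v => match v with | .root => 2 | .safe _ => 1 | _ => 0) ?_
    rintro (_ | i | i | ⟨i, j⟩) v (hv | hv) <;> simp at hv
    all_goals obtain ⟨i, rfl⟩ := hv; simp

/-- The rule that replaces an instance of `d(x ; p)` by its subgraph at `r`. -/
abbrev patRule (r : PatNode k (patArity pat ar)) (hr : PatNode.root ≠ r) : Rule S where
  graph := patGraph d k pat
  wf := patGraph_wellFormed hk hl pat
  l := .root
  r := r
  ne := hr
  sep_l := patGraph_separated pat _
  sep_r := patGraph_separated pat _

theorem patRule_isSubgraphRule (r : PatNode k (patArity pat ar)) (hr : PatNode.root ≠ r) :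
    (patRule hk hl pat r hr).IsSubgraphRule :=
  ⟨patGraph_reach pat r, hr.symm⟩

theorem patRule_ok {J : Interp S} {W : S.D → Polynomial ℕ} (hW : W d = 1)
    (r : PatNode k (patArity pat ar)) (hr : PatNode.root ≠ r)
    (hsem : ∀ ε : PatNode k (patArity pat ar) → Tm ar,
      (∀ i c, pat i = some c →
        ε (.safe i) = J.val (.inl c) [] (List.ofFn fun j => ε (.sub i j))) →
      ε r = J.val (.inr d) (List.ofFn fun i => ε (.normal i)) (List.ofFn fun i => ε (.safe i))) :
    RuleOK J W d (patRule hk hl pat r hr) where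
  lab_l := rfl
  cons := by
    rintro (_ | i | i | ⟨i, j⟩) - hne f hf <;> simp at hf hne
    obtain ⟨c, -, rfl⟩ := hf
    exact ⟨c, rfl⟩
  no_edge := by rintro (_ | i | i | ⟨i, j⟩) (h | h) <;> simp at h
  new_lab v hv := absurd (patGraph_reach pat v) hv
  new_nsucc v hv := absurd (patGraph_reach pat v) hv
  eval ε hε := by
    refine ⟨ε, fun _ _ => rfl, fun v hv => absurd (patGraph_reach pat v) hv, ?_⟩
    have h0 := hε .root Relation.ReflTransGen.refl _ rfl
    simp only [List.map_ofFn, Function.comp_def] at h0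
    rw [h0]
    refine hsem ε fun i c hc => ?_
    have h1 := hε (.safe i) (patGraph_reach pat _) (.inl c) (by simp [hc])
    simpa only [List.map_ofFn, Function.comp_def, List.map_nil] using h1
  weight ε hε n _ _ := by
    have : IsEmpty {w : (patRule hk hl pat r hr).graph.V //
        ¬ (patRule hk hl pat r hr).graph.Reach (patRule hk hl pat r hr).l w} :=
      ⟨fun w => w.2 (patGraph_reach pat w.1)⟩
    simp [hW]

/-- The rule applies to every node with label `d` whose safe arguments have the labels prescribed
by the patterns. -/
theorem exists_patRule_hom {G : Graph S} (hG : G.WellFormed) {u : G.V}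
    (hu : G.lab u = some (.inr d)) (r : PatNode k (patArity pat ar)) (hr : PatNode.root ≠ r)
    (ws : Fin l → G.V) (hws : G.ssucc u = List.ofFn ws)
    (hpat : ∀ i c, pat i = some c → G.lab (ws i) = some (.inl c)) :
    ∃ φ : ((patRule hk hl pat r hr).graph.sub (patRule hk hl pat r hr).l).V → G.V,
      Graph.IsHom ((patRule hk hl pat r hr).graph.sub (patRule hk hl pat r hr).l) G φ ∧
        redexRoot φ = u := by
  obtain ⟨vs, hvs⟩ := exists_eq_ofFn ((hG.nlen u _ hu).trans hk)
  refine ⟨_, Graph.isHom_comp_val (G := patGraph d k pat) (fun v => match v with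
    | .root => u
    | .normal i => vs i
    | .safe i => ws i
    | .sub i j => (G.ssucc (ws i)).getD j u) ?_, rfl⟩
  rintro (_ | i | i | ⟨i, j⟩) - s hs <;> simp at hs
  · subst hs
    simp only [List.map_ofFn]
    exact ⟨hu, hvs, hws⟩
  · obtain ⟨c, hc, rfl⟩ := hs
    have hlab := hpat i c hc
    simp only [List.map_ofFn, List.map_nil]
    refine ⟨hlab, hG.nsucc_eq_nil hlab, eq_ofFn_getD _ _ ?_⟩
    rw [hG.slen _ _ hlab]
    simp [Signature.sar, patArity, hc]

end Pattern

theorem implementable_proj {J : Interp S} {W : S.D → Polynomial ℕ} {d : S.D} {k l : ℕ}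
    (hk : S.normal d = k) (hl : S.safe d = l) (hW : W d = 1) (r : Fin k ⊕ Fin l)
    (hsem : ∀ x y, J.val (.inr d) (List.ofFn x) (List.ofFn y) = Sum.elim x y r) :
    Implementable J W d := by
  let r' : PatNode k (patArity (fun _ : Fin l => none) ar) := Sum.elim .normal .safe r
  have hr : PatNode.root ≠ r' := by rcases r with r | r <;> simp [r']
  refine ⟨{patRule hk hl (fun _ => none) r' hr}, ?_, ?_, Or.inr ⟨Set.finite_singleton _, ?_⟩⟩
  · rintro _ rfl
    refine patRule_ok hk hl _ hW r' hr fun ε _ => ?_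
    rw [hsem]
    rcases r with r | r <;> rfl
  · intro G ε u hG _ hu _ _
    obtain ⟨ws, hws⟩ := exists_eq_ofFn ((hG.slen u _ hu).trans hl)
    exact ⟨_, rfl, exists_patRule_hom hk hl _ hG hu r' hr ws hws (by simp)⟩
  · rintro _ rfl
    exact Or.inl (patRule_isSubgraphRule hk hl _ r' hr)

/-- A function that distinguishes the outermost constructor `c` of its first safe argument and
returns, depending on `c`, that argument, one of its subterms or another argument. -/
theorem implementable_case [Finite C] {J : Interp S} {W : S.D → Polynomial ℕ} {d : S.D} {l : ℕ}
    (hk : S.normal d = 0) (hl : S.safe d = l + 1) (hW : W d = 1)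
    (sel : ∀ c, Option (Fin (ar c) ⊕ Fin l))
    (hsem : ∀ c a (y : Fin l → Tm ar), J.val (.inr d) [] (.mk c a :: List.ofFn y) =
      (sel c).elim (.mk c a) (Sum.elim a y)) :
    Implementable J W d := by
  let pat : C → Fin (l + 1) → Option C := fun c => Fin.cons (some c) fun _ => none
  let r : ∀ c, PatNode 0 (patArity (pat c) ar) := fun c =>
    (sel c).elim (.safe 0) (Sum.elim (fun i => .sub 0 i) (fun i => .safe i.succ))
  have hr : ∀ c, PatNode.root ≠ r c := by
    intro c
    simp only [r]
    rcases sel c with _ | s | s <;> simp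
  refine ⟨Set.range fun c => patRule hk hl (pat c) (r c) (hr c), ?_, ?_,
    Or.inr ⟨Set.finite_range _, ?_⟩⟩
  · rintro _ ⟨c, rfl⟩
    refine patRule_ok hk hl _ hW (r c) (hr c) fun ε hε => ?_
    have h0 := hε 0 c rfl
    rw [List.ofFn_succ, List.ofFn_zero]
    have h1 : ε (.safe 0) = .mk c fun j => ε (.sub 0 j) := h0.trans (J.val_constr c _)
    rw [h1, hsem]
    simp only [r]
    rcases sel c with _ | s | s
    · exact h1
    · rfl
    · rfl
  · intro G ε u hG _ hu hcons _
    obtain ⟨ws, hws⟩ := exists_eq_ofFn ((hG.slen u _ hu).trans hl)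
    obtain ⟨c, hc⟩ := hcons (ws 0) (Or.inr (by simp [hws])) (ws 0) Relation.ReflTransGen.refl
    refine ⟨_, ⟨c, rfl⟩, exists_patRule_hom hk hl _ hG hu (r c) (hr c) ws hws ?_⟩
    intro i b hb
    induction i using Fin.cases with
    | zero =>
      obtain rfl : c = b := by simpa [pat] using hb
      exact hc
    | succ i => simp [pat] at hb
  · rintro _ ⟨c, rfl⟩
    exact Or.inl (patRule_isSubgraphRule hk hl _ (r c) (hr c))

/-! ### Rules for composition -/

/-- The nodes of a rule `d(x ; z) → s(x' ; g₁(x ; z), …, g_q(x ; z))`. -/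
inductive CompNode (k l q : ℕ) : Type
  | left : CompNode k l q
  | right : CompNode k l q
  | x (i : Fin k) : CompNode k l q
  | z (i : Fin l) : CompNode k l q
  | w (i : Fin q) : CompNode k l q

instance CompNode.finite (k l q : ℕ) : Finite (CompNode k l q) := by
  refine Finite.of_injective (β := Bool ⊕ Fin k ⊕ Fin l ⊕ Fin q) (fun
    | .left => .inl true
    | .right => .inl false
    | .x i => .inr (.inl i)
    | .z i => .inr (.inr (.inl i))
    | .w i => .inr (.inr (.inr i))) ?_
  rintro (_ | _ | _ | _ | _) (_ | _ | _ | _ | _) h <;> simp_all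

/-- The graph of the rule `d(x ; z) → s(x_{j₁}, …, x_{j_m} ; g₁(x ; z), …, g_q(x ; z))`, whose head
`s` may be a constructor. -/
abbrev compGraph (d : S.D) (s : S.Sym) {k l m q : ℕ} (j : Fin m → Fin k) (g : Fin q → S.D) :
    Graph S where
  V := CompNode k l q
  lab
    | .left => some (.inr d)
    | .right => some s
    | .w i => some (.inr (g i))
    | _ => none
  nsucc
    | .left => List.ofFn .x
    | .right => List.ofFn fun i => .x (j i)
    | .w _ => List.ofFn .x
    | _ => []
  ssucc
    | .left => List.ofFn .z
    | .right => List.ofFn .w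
    | .w _ => List.ofFn .z
    | _ => []

section Composition

variable {d : S.D} {s : S.Sym} {k l m q : ℕ} (j : Fin m → Fin k) (g : Fin q → S.D)

theorem compGraph_reach_left {v : CompNode k l q} :
    (compGraph d s j g).Reach .left v ↔ v = .left ∨ (∃ i, v = .x i) ∨ ∃ i, v = .z i := by
  constructor
  · intro h
    refine Graph.Reach.mem_of_closed (G := compGraph d s j g)
      (M := {v | v = .left ∨ (∃ i, v = .x i) ∨ ∃ i, v = .z i}) ?_ (Or.inl rfl) h
    rintro _ (rfl | ⟨i, rfl⟩ | ⟨i, rfl⟩) v (hv | hv) <;> simp at hv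
    · obtain ⟨i, rfl⟩ := hv; exact Or.inr (Or.inl ⟨i, rfl⟩)
    · obtain ⟨i, rfl⟩ := hv; exact Or.inr (Or.inr ⟨i, rfl⟩)
  · rintro (rfl | ⟨i, rfl⟩ | ⟨i, rfl⟩)
    · exact Relation.ReflTransGen.refl
    · exact Relation.ReflTransGen.single (Or.inl (by simp))
    · exact Relation.ReflTransGen.single (Or.inr (by simp))

/-- The arities fit together in a rule `d(x ; z) → s(x_{j₁}, …, x_{j_m} ; g(x ; z))`. -/
structure CompArity (d : S.D) (s : S.Sym) (k l m q : ℕ) (g : Fin q → S.D) : Prop where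
  normal : S.normal d = k
  safe : S.safe d = l
  nar : S.nar s = m
  sar : S.sar s = q
  normal_g : ∀ i, S.normal (g i) = k
  safe_g : ∀ i, S.safe (g i) = l

variable {g} (ha : CompArity d s k l m q g)

include ha in
theorem compGraph_separated (a : CompNode k l q) :
    (compGraph (l := l) d s j g).Separated a := by
  refine Graph.separated_of_coloring (G := compGraph d s j g)
    (fun v => match v with | .x _ => True | _ => False) ?_ ?_ ?_ a
  · rintro (_ | _ | i | i | i) - v hv <;> simp at hv <;> (obtain ⟨i, rfl⟩ := hv; trivial)
  · rintro (_ | _ | i | i | i) - v hv <;> simp at hv <;> (obtain ⟨i, rfl⟩ := hv; exact id)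
  · rintro (_ | _ | i | i | i) v ⟨c, hc⟩ (hv | hv) <;> simp at hc hv
    · -- constructors have no normal positions, so that `m = 0`
      obtain ⟨i, rfl⟩ := hv
      have hm := ha.nar
      rw [hc] at hm
      exact absurd i.2 (by simp [← hm, Signature.nar])
    · obtain ⟨i, rfl⟩ := hv
      rfl

include ha in
theorem compGraph_wellFormed : (compGraph (l := l) d s j g).WellFormed where
  finite := inferInstanceAs (Finite (CompNode k l q))
  nlen := by
    rintro (_ | _ | i | i | i) f hf <;> simp at hf <;> subst hf
    · simp [Signature.nar, ha.normal]
    · simp [ha.nar]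
    · simp [Signature.nar, ha.normal_g]
  slen := by
    rintro (_ | _ | i | i | i) f hf <;> simp at hf <;> subst hf
    · simp [Signature.sar, ha.safe]
    · simp [ha.sar]
    · simp [Signature.sar, ha.safe_g]
  unlabeled := by rintro (_ | _ | i | i | i) hf <;> simp at hf <;> simp
  acyclic := by
    refine Graph.acyclic_of_rank (G := compGraph d s j g)
      (fun v => match v with | .left => 1 | .right => 2 | .w _ => 1 | _ => 0) ?_
    rintro (_ | _ | i | i | i) v (hv | hv) <;> simp at hv <;> (obtain ⟨i, rfl⟩ := hv; simp)

/-- The rule `d(x ; z) → s(x_{j₁}, …, x_{j_m} ; g₁(x ; z), …, g_q(x ; z))`. -/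
abbrev compRule : Rule S where
  graph := compGraph (l := l) d s j g
  wf := compGraph_wellFormed j ha
  l := .left
  r := .right
  ne := by simp
  sep_l := compGraph_separated j ha _
  sep_r := compGraph_separated j ha _

theorem compRule_safeComposition : Nonempty (SafeComposition (compRule j ha)) := ⟨{
  k := k
  l := l
  m := m
  q := q
  u := .left
  v := .right
  x := .x
  z := .z
  w := .w
  nodes := by
    constructor
    · rintro (_ | _ | _ | _ | _) (_ | _ | _ | _ | _) h <;> simp_all
    · rintro (_ | _ | i | i | i)
      · exact ⟨.inl (), rfl⟩
      · exact ⟨.inr (.inl ()), rfl⟩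
      · exact ⟨.inr (.inr (.inl i)), rfl⟩
      · exact ⟨.inr (.inr (.inr (.inl i))), rfl⟩
      · exact ⟨.inr (.inr (.inr (.inr i))), rfl⟩
  l_eq := rfl
  r_eq := rfl
  lab_u := by simp
  lab_v := by simp
  lab_w := by simp
  lab_x := by simp
  lab_z := by simp
  nsucc_u := rfl
  ssucc_u := rfl
  j := j
  nsucc_v := rfl
  ssucc_v := rfl
  nsucc_w := fun _ => rfl
  ssucc_w := fun _ => rfl }⟩

theorem compRule_ok {J : Interp S} {W : S.D → Polynomial ℕ}
    (hW : ∀ n, labWeight W n (some s) + ∑ i, (W (g i)).eval n + q + 2 ≤ (W d).eval n)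
    (hsem : ∀ (x : Fin k → Tm ar) (z : Fin l → Tm ar),
      J.val (.inr d) (List.ofFn x) (List.ofFn z) = J.val s (List.ofFn fun i => x (j i))
        (List.ofFn fun i => J.val (.inr (g i)) (List.ofFn x) (List.ofFn z))) :
    RuleOK J W d (compRule j ha) where
  lab_l := rfl
  cons v hv hne f hf := by
    rcases (compGraph_reach_left j g).mp hv with rfl | ⟨i, rfl⟩ | ⟨i, rfl⟩ <;> simp at hf hne
  no_edge := by rintro (_ | _ | i | i | i) (h | h) <;> simp at h
  new_lab v hv := by
    rcases v with _ | _ | i | i | i <;> simp [compGraph_reach_left] at hv ⊢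
  new_nsucc v _ u hu := by
    have hx : ∀ i, (CompNode.x i : CompNode k l q) ∈
        (compRule j ha).graph.belowNormal (compRule j ha).l := fun i =>
      ⟨.x i, by simp, Relation.ReflTransGen.refl⟩
    rcases v with _ | _ | i | i | i <;> simp at hu <;> (obtain ⟨i, rfl⟩ := hu; exact hx _)
  eval ε₀ hε₀ := by
    have h0 := hε₀ .left Relation.ReflTransGen.refl _ rfl
    simp only [List.map_ofFn, Function.comp_def] at h0
    rw [hsem] at h0
    refine ⟨fun v => match v with
      | .right => ε₀ .left
      | .w i => J.val (.inr (g i)) (List.ofFn fun i => ε₀ (.x i)) (List.ofFn fun i => ε₀ (.z i))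
      | v => ε₀ v, ?_, ?_, rfl⟩
    · intro v hv
      rcases (compGraph_reach_left j g).mp hv with rfl | ⟨i, rfl⟩ | ⟨i, rfl⟩ <;> rfl
    · rintro (_ | _ | i | i | i) hv f hf <;> simp [compGraph_reach_left] at hf hv <;> subst hf
      · simp only [List.map_ofFn, Function.comp_def]
        exact h0
      · simp only [List.map_ofFn, Function.comp_def]
  weight ε₀ _ n _ _ := by
    have h := sum_not_reach_le
      (P := fun w => ¬ (compRule j ha).graph.Reach (compRule j ha).l w)
      (fun o : Option (Fin q) => o.elim CompNode.right CompNode.w) (by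
        rintro (_ | _ | i | i | i) hv <;> simp [compGraph_reach_left] at hv
        · exact ⟨none, rfl⟩
        · exact ⟨some i, rfl⟩) (fun w => 1 + labWeight W n ((compRule j ha).graph.lab w))
    rw [Fintype.sum_option] at h
    simp only [Option.elim_none, Option.elim_some, Finset.sum_add_distrib, labWeight_inr,
      Finset.sum_const, Finset.card_univ, Fintype.card_fin, smul_eq_mul, mul_one] at h ⊢
    have := hW n
    omega

include ha in
theorem implementable_comp {J : Interp S} {W : S.D → Polynomial ℕ}
    (hW : ∀ n, labWeight W n (some s) + ∑ i, (W (g i)).eval n + q + 2 ≤ (W d).eval n)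
    (hsem : ∀ (x : Fin k → Tm ar) (z : Fin l → Tm ar),
      J.val (.inr d) (List.ofFn x) (List.ofFn z) = J.val s (List.ofFn fun i => x (j i))
        (List.ofFn fun i => J.val (.inr (g i)) (List.ofFn x) (List.ofFn z))) :
    Implementable J W d := by
  refine ⟨{compRule j ha}, ?_, ?_, Or.inr ⟨Set.finite_singleton _, ?_⟩⟩
  · rintro _ rfl
    exact compRule_ok j ha hW hsem
  · intro G ε u hG _ hu _ _
    obtain ⟨vs, hvs⟩ := exists_eq_ofFn ((hG.nlen u _ hu).trans ha.normal)
    obtain ⟨ws, hws⟩ := exists_eq_ofFn ((hG.slen u _ hu).trans ha.safe)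
    refine ⟨_, rfl, _, Graph.isHom_comp_val (G := compGraph d s j g) (fun v => match v with
      | .x i => vs i
      | .z i => ws i
      | _ => u) ?_, rfl⟩
    intro v hv f hf
    rcases (compGraph_reach_left j g).mp hv with rfl | ⟨i, rfl⟩ | ⟨i, rfl⟩ <;> simp at hf
    subst hf
    simp only [List.map_ofFn]
    exact ⟨hu, hvs, hws⟩
  · rintro _ rfl
    exact Or.inr (compRule_safeComposition j ha)

end Composition

/-! ### Unfolding rules for recursion -/

/-- The number of constructor occurrences. -/
def Tm.size : Tm ar → ℕ
  | .mk _ a => 1 + ∑ i, (a i).size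

theorem Tm.size_lt (c : C) (a : Fin (ar c) → Tm ar) (i : Fin (ar c)) :
    (a i).size < (Tm.mk c a).size := by
  have := Finset.single_le_sum (f := fun i => (a i).size) (fun _ _ => Nat.zero_le _)
    (Finset.mem_univ i)
  rw [Tm.size]
  omega

/-- A maximally shared constructor graph with nodes `0, …, m` and root `0`; the term represented by
the node `j` is `τ j`. -/
structure SharedDag (ar : C → ℕ) where
  m : ℕ
  lbl : Fin (m + 1) → C
  sc : ∀ j, Fin (ar (lbl j)) → Fin (m + 1)
  τ : Fin (m + 1) → Tm ar
  τ_inj : Function.Injective τ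
  τ_eq : ∀ j, τ j = .mk (lbl j) fun i => τ (sc j i)
  reach : ∀ j, Relation.ReflTransGen (fun a b => ∃ i, b = sc a i) 0 j

/-- The nodes of an unfolding rule. -/
inductive UnfNode (k l m : ℕ) : Type
  | y : UnfNode k l m
  | v (i : Fin (m + 1)) : UnfNode k l m
  | w (i : Fin (m + 1)) : UnfNode k l m
  | x (i : Fin k) : UnfNode k l m
  | z (i : Fin l) : UnfNode k l m

instance UnfNode.finite (k l m : ℕ) : Finite (UnfNode k l m) := by
  refine Finite.of_injective (β := Unit ⊕ Fin (m + 1) ⊕ Fin (m + 1) ⊕ Fin k ⊕ Fin l) (fun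
    | .y => .inl ()
    | .v i => .inr (.inl i)
    | .w i => .inr (.inr (.inl i))
    | .x i => .inr (.inr (.inr (.inl i)))
    | .z i => .inr (.inr (.inr (.inr i)))) ?_
  rintro (_ | _ | _ | _ | _) (_ | _ | _ | _ | _) h <;> simp_all

/-- The graph of the unfolding rule for `d` along `T`, where `h` assigns to each constructor the
symbol of the corresponding recursion equation. -/
abbrev unfGraph (d : S.D) (h : C → S.D) (k l : ℕ) (T : SharedDag ar) : Graph S where
  V := UnfNode k l T.m
  lab
    | .y => some (.inr d)
    | .v j => some (.inl (T.lbl j))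
    | .w j => some (.inr (h (T.lbl j)))
    | _ => none
  nsucc
    | .y => .v 0 :: List.ofFn .x
    | .w j => List.ofFn (fun i => .v (T.sc j i)) ++ List.ofFn .x
    | _ => []
  ssucc
    | .y => List.ofFn .z
    | .v j => List.ofFn (fun i => .v (T.sc j i))
    | .w j => List.ofFn .z ++ List.ofFn (fun i => .w (T.sc j i))
    | _ => []

/-- The arities fit together in a recursion for `d` with the step functions `h`. -/
structure RecArity (d : S.D) (h : C → S.D) (k l : ℕ) : Prop where
  normal : S.normal d = k + 1
  safe : S.safe d = l
  normal_h : ∀ c, S.normal (h c) = ar c + k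
  safe_h : ∀ c, S.safe (h c) = l + ar c
  inj : Function.Injective h
  ne : ∀ c, h c ≠ d

section Unfolding

variable {d : S.D} {h : C → S.D} {k l : ℕ} (T : SharedDag ar)

theorem unfGraph_reach_v {j : Fin (T.m + 1)} : (unfGraph d h k l T).Reach (.v 0) (.v j) := by
  induction T.reach j with
  | refl => exact Relation.ReflTransGen.refl
  | tail _ hb ih =>
    obtain ⟨i, rfl⟩ := hb
    exact ih.tail (Or.inr (by simp))

theorem unfGraph_reach_y {v : UnfNode k l T.m} :
    (unfGraph d h k l T).Reach .y v ↔ ∀ j, v ≠ .w j := by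
  constructor
  · intro hv
    refine Graph.Reach.mem_of_closed (G := unfGraph d h k l T) (M := {v | ∀ j, v ≠ .w j})
      ?_ (by simp) hv
    rintro (_ | j | j | i | i) hu v (hv | hv) j <;> simp at hu hv
    · rcases hv with rfl | ⟨i, rfl⟩ <;> simp
    · obtain ⟨i, rfl⟩ := hv; simp
    · obtain ⟨i, rfl⟩ := hv; simp
  · intro hv
    rcases v with _ | j | j | i | i
    · exact Relation.ReflTransGen.refl
    · exact Relation.ReflTransGen.head (Or.inl (by simp)) (unfGraph_reach_v T)
    · exact absurd rfl (hv j)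
    · exact Relation.ReflTransGen.single (Or.inl (by simp))
    · exact Relation.ReflTransGen.single (Or.inr (by simp))

theorem unfGraph_separated (a : UnfNode k l T.m) : (unfGraph d h k l T).Separated a := by
  refine Graph.separated_of_coloring (G := unfGraph d h k l T)
    (fun v => match v with | .x _ => True | .v _ => True | _ => False) ?_ ?_ ?_ a
  · rintro (_ | j | j | i | i) hd v hv <;> simp at hv
    · rcases hv with rfl | ⟨i, rfl⟩ <;> trivial
    · rcases hv with ⟨i, rfl⟩ | ⟨i, rfl⟩ <;> trivial
  · rintro (_ | j | j | i | i) ⟨f, hf⟩ v hv <;> simp at hf hv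
    · obtain ⟨i, rfl⟩ := hv; exact id
    · rcases hv with ⟨i, rfl⟩ | ⟨i, rfl⟩ <;> exact id
  · rintro (_ | j | j | i | i) v ⟨c, hc⟩ (hv | hv) <;> simp at hc hv
    obtain ⟨i, rfl⟩ := hv
    rfl

variable (ha : RecArity d h k l)

include ha in
theorem unfGraph_wellFormed : (unfGraph d h k l T).WellFormed where
  finite := inferInstanceAs (Finite (UnfNode k l T.m))
  nlen := by
    rintro (_ | j | j | i | i) f hf <;> simp at hf <;> subst hf
    · simp [Signature.nar, ha.normal]
    · simp [Signature.nar]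
    · simp [Signature.nar, ha.normal_h]
  slen := by
    rintro (_ | j | j | i | i) f hf <;> simp at hf <;> subst hf
    · simp [Signature.sar, ha.safe]
    · simp [Signature.sar]
    · simp [Signature.sar, ha.safe_h]
  unlabeled := by rintro (_ | j | j | i | i) hf <;> simp at hf <;> simp
  acyclic := by
    -- below `y` and all `w j` come the nodes `v j`, ranked by the sizes of their terms
    have hsz : ∀ j i, (T.τ (T.sc j i)).size < (T.τ j).size := fun j i => by
      rw [T.τ_eq j]
      exact Tm.size_lt (T.lbl j) (fun i => T.τ (T.sc j i)) i
    have hle : ∀ j, (T.τ j).size ≤ ∑ j, (T.τ j).size := fun j =>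
      Finset.single_le_sum (f := fun j => (T.τ j).size) (fun _ _ => Nat.zero_le _)
        (Finset.mem_univ j)
    refine Graph.acyclic_of_rank (G := unfGraph d h k l T)
      (fun v => match v with
        | .y => ∑ j, (T.τ j).size + 1
        | .v j => (T.τ j).size
        | .w j => ∑ j, (T.τ j).size + 1 + (T.τ j).size
        | _ => 0) ?_
    rintro (_ | j | j | i | i) v (hv | hv) <;> simp at hv
    · rcases hv with rfl | ⟨i, rfl⟩
      · have := hle 0
        simp only
        omega
      · simp
    · obtain ⟨i, rfl⟩ := hv
      simp
    · obtain ⟨i, rfl⟩ := hv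
      exact hsz j i
    · rcases hv with ⟨i, rfl⟩ | ⟨i, rfl⟩
      · have := hle (T.sc j i)
        simp only
        omega
      · simp
    · rcases hv with ⟨i, rfl⟩ | ⟨i, rfl⟩
      · simp
      · have := hsz j i
        simp only
        omega

/-- The unfolding rule for `d` along `T`. -/
abbrev unfRule : Rule S where
  graph := unfGraph d h k l T
  wf := unfGraph_wellFormed T ha
  l := .y
  r := .w 0
  ne := by simp
  sep_l := unfGraph_separated T _
  sep_r := unfGraph_separated T _

theorem unfRule_safeUnfolding : Nonempty (SafeUnfolding (unfRule T ha)) := ⟨{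
  A := Set.range .inl
  B := Set.range fun c => .inr (h c)
  disj := by
    rw [Set.disjoint_left]
    rintro _ ⟨c, rfl⟩ ⟨b, hb⟩
    simp at hb
  β := Sum.elim (fun c => .inr (h c)) .inr
  bij := by
    refine ⟨?_, ?_, ?_⟩
    · rintro _ ⟨c, rfl⟩
      exact ⟨c, rfl⟩
    · rintro _ ⟨c, rfl⟩ _ ⟨b, rfl⟩ hcb
      exact congrArg Sum.inl (ha.inj (Sum.inr_injective hcb))
    · rintro _ ⟨c, rfl⟩
      exact ⟨_, ⟨c, rfl⟩, rfl⟩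
  k := k
  l := l
  nar_β := by
    rintro _ ⟨c, rfl⟩
    simp [Signature.nar, Signature.sar, ha.normal_h]
  sar_β := by
    rintro _ ⟨c, rfl⟩
    simp [Signature.nar, Signature.sar, ha.safe_h]
  f := .inr d
  f_notMem := by
    rintro (⟨c, hc⟩ | ⟨c, hc⟩)
    · simp at hc
    · exact ha.ne c (Sum.inr_injective hc)
  nar_f := by simp [Signature.nar, ha.normal, add_comm]
  sar_f := ha.safe
  m := T.m
  y := .y
  v := .v
  w := .w
  x := .x
  z := .z
  nodes := by
    constructor
    · rintro (_ | _ | _ | _ | _) (_ | _ | _ | _ | _) h <;> simp_all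
    · rintro (_ | i | i | i | i)
      · exact ⟨.inl (), rfl⟩
      · exact ⟨.inr (.inl i), rfl⟩
      · exact ⟨.inr (.inr (.inl i)), rfl⟩
      · exact ⟨.inr (.inr (.inr (.inl i))), rfl⟩
      · exact ⟨.inr (.inr (.inr (.inr i))), rfl⟩
  l_eq := rfl
  r_eq := rfl
  lab_y := rfl
  nsucc_y := rfl
  ssucc_y := rfl
  lab_x := fun _ => rfl
  lab_z := fun _ => rfl
  s := fun j => List.ofFn (T.sc j)
  succ_v := fun j => by simp [List.map_ofFn, Function.comp_def]
  below_v := by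
    ext v
    constructor
    · intro hv
      refine Graph.Reach.mem_of_closed (G := unfGraph d h k l T) (M := Set.range UnfNode.v)
        ?_ ⟨0, rfl⟩ hv
      rintro _ ⟨j, rfl⟩ v (hv | hv) <;> simp at hv
      obtain ⟨i, rfl⟩ := hv
      exact ⟨_, rfl⟩
    · rintro ⟨j, rfl⟩
      exact unfGraph_reach_v T
  lab_v := fun j => ⟨_, ⟨T.lbl j, rfl⟩, rfl, rfl⟩
  nsucc_w := fun j => by simp [List.map_ofFn, Function.comp_def]
  ssucc_w := fun j => by simp [List.map_ofFn, Function.comp_def] }⟩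

theorem unfRule_ok [Fintype C] {J : Interp S} {W : S.D → Polynomial ℕ}
    (hW : W d = Polynomial.X * ∑ c, (1 + W (h c)) + 1)
    (hsem : ∀ c (a : Fin (ar c) → Tm ar) (x : Fin k → Tm ar) (z : Fin l → Tm ar),
      J.val (.inr d) (.mk c a :: List.ofFn x) (List.ofFn z) =
        J.val (.inr (h c)) (List.ofFn a ++ List.ofFn x)
          (List.ofFn z ++
            List.ofFn fun i => J.val (.inr d) (a i :: List.ofFn x) (List.ofFn z))) :
    RuleOK J W d (unfRule T ha) where
  lab_l := rfl
  cons v hv hne f hf := by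
    rw [unfGraph_reach_y] at hv
    rcases v with _ | j | j | i | i <;> simp at hf hne hv
    exact ⟨_, hf.symm⟩
  no_edge := by rintro (_ | j | j | i | i) (hv | hv) <;> simp at hv
  new_lab v hv := by
    rcases v with _ | j | j | i | i <;> simp [unfGraph_reach_y] at hv ⊢
  new_nsucc v hv u hu := by
    rcases v with _ | j | j | i | i <;> simp [unfGraph_reach_y] at hv hu
    rcases hu with ⟨i, rfl⟩ | ⟨i, rfl⟩
    · exact ⟨.v 0, by simp, unfGraph_reach_v T⟩
    · exact ⟨.x i, by simp, Relation.ReflTransGen.refl⟩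
  eval ε₀ hε₀ := by
    have h0 := hε₀ .y Relation.ReflTransGen.refl _ rfl
    simp only [List.map_ofFn, List.map_cons, Function.comp_def] at h0
    refine ⟨fun v => match v with
      | .w j => J.val (.inr d) (ε₀ (.v j) :: List.ofFn fun i => ε₀ (.x i))
          (List.ofFn fun i => ε₀ (.z i))
      | v => ε₀ v, ?_, ?_, h0.symm⟩
    · intro v hv
      rw [unfGraph_reach_y] at hv
      rcases v with _ | j | j | i | i <;> first | rfl | exact absurd rfl (hv j)
    · rintro (_ | j | j | i | i) hv f hf <;> simp [unfGraph_reach_y] at hf hv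
      subst hf
      have h1 := hε₀ (.v j) ((unfGraph_reach_y T).mpr (by simp)) _ rfl
      simp only [List.map_ofFn, List.map_nil, Function.comp_def] at h1
      rw [J.val_constr] at h1
      simp only [List.map_append, List.map_ofFn, Function.comp_def]
      rw [h1, hsem]
  weight ε₀ hε₀ n hn _ := by
    -- the values of the nodes `v j` are the pairwise distinct terms `τ j`
    have hval : ∀ t j, T.τ j = t → ε₀ (.v j) = t := by
      intro t
      induction t with
      | mk c a ih =>
        intro j hj
        have h1 := hε₀ (.v j) ((unfGraph_reach_y T).mpr (by simp)) _ rfl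
        simp only [List.map_ofFn, List.map_nil, Function.comp_def] at h1
        rw [J.val_constr] at h1
        rw [h1, ← hj, T.τ_eq j]
        rw [T.τ_eq j] at hj
        cases hj
        congr 1
        exact funext fun i => ih i _ rfl
    have hm : T.m + 1 ≤ n := by
      refine le_trans ?_ hn
      have hsub : Set.range T.τ ⊆ ε₀ '' (unfRule T ha).graph.belowNormal (unfRule T ha).l := by
        rintro _ ⟨j, rfl⟩
        exact ⟨.v j, ⟨.v 0, by simp, unfGraph_reach_v T⟩, hval _ j rfl⟩
      have hcard : (Set.range T.τ).ncard = T.m + 1 := by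
        rw [← Set.image_univ, Set.ncard_image_of_injective _ T.τ_inj, Set.ncard_univ]
        simp
      rw [← hcard]
      exact Set.ncard_le_ncard hsub ((Set.toFinite _).image _)
    have h1 := sum_not_reach_le
      (P := fun w => ¬ (unfRule T ha).graph.Reach (unfRule T ha).l w) UnfNode.w (by
        rintro (_ | j | j | i | i) hv <;> simp [unfGraph_reach_y] at hv
        exact ⟨j, rfl⟩) (fun w => 1 + labWeight W n ((unfRule T ha).graph.lab w))
    have h2 : ∑ j, (1 + labWeight W n ((unfRule T ha).graph.lab (.w j))) ≤
        (T.m + 1) * ∑ c, (1 + (W (h c)).eval n) := by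
      refine (Finset.sum_le_card_nsmul _ _ (∑ c, (1 + (W (h c)).eval n)) fun j _ => ?_).trans
        (by simp)
      exact Finset.single_le_sum (f := fun c => 1 + (W (h c)).eval n) (fun _ _ => Nat.zero_le _)
        (Finset.mem_univ (T.lbl j))
    have h3 := Nat.mul_le_mul_right (∑ c, (1 + (W (h c)).eval n)) hm
    simp only [hW, Polynomial.eval_add, Polynomial.eval_mul, Polynomial.eval_X,
      Polynomial.eval_finsetSum, Polynomial.eval_one]
    exact Nat.add_le_add_right (h1.trans (h2.trans h3)) 1

/-- Every constructor graph that is evaluated injectively is a copy of a `SharedDag`. -/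
theorem exists_sharedDag {J : Interp S} {G : Graph S} (hG : G.WellFormed) {ε : G.V → Tm ar}
    (hε : ∀ v, EvalAt J G ε v) {a : G.V} (hcons : ∀ v, G.Reach a v → G.IsConsNode v)
    (hinj : Set.InjOn ε (G.below a)) :
    ∃ (T : SharedDag ar) (ν : Fin (T.m + 1) → G.V), ν 0 = a ∧
      ∀ j, G.lab (ν j) = some (.inl (T.lbl j)) ∧
        G.ssucc (ν j) = List.ofFn fun i => ν (T.sc j i) := by
  have := hG.finite
  obtain ⟨N, ⟨e₀⟩⟩ := Finite.exists_equiv_fin {v // G.Reach a v}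
  obtain ⟨m, rfl⟩ : ∃ m, N = m + 1 :=
    Nat.exists_eq_succ_of_ne_zero (by rintro rfl; exact (e₀ ⟨a, Relation.ReflTransGen.refl⟩).elim0)
  obtain ⟨e, he⟩ : ∃ e : {v // G.Reach a v} ≃ Fin (m + 1),
      e ⟨a, Relation.ReflTransGen.refl⟩ = 0 :=
    ⟨e₀.trans (Equiv.swap (e₀ ⟨a, Relation.ReflTransGen.refl⟩) 0), by simp⟩
  choose lbl hlbl using fun j => hcons (e.symm j).1 (e.symm j).2
  choose vs hvs using fun j => Graph.exists_ofFn_ssucc hG (hlbl j)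
  have hedge : ∀ j i, G.Edge (e.symm j).1 (vs j i) := fun j i => Or.inr (by simp [hvs])
  let sc : ∀ j, Fin (ar (lbl j)) → Fin (m + 1) := fun j i =>
    e ⟨vs j i, (e.symm j).2.tail (hedge j i)⟩
  have hsc : ∀ j i, (e.symm (sc j i)).1 = vs j i := fun j i => by simp [sc]
  refine ⟨⟨m, lbl, sc, fun j => ε (e.symm j).1, ?_, ?_, ?_⟩, fun j => (e.symm j).1, ?_, ?_⟩
  · intro i j hij
    exact e.symm.injective (Subtype.ext (hinj (e.symm i).2 (e.symm j).2 hij))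
  · intro j
    rw [hε _ _ (hlbl j), hG.nsucc_eq_nil (hlbl j), hvs, List.map_nil, List.map_ofFn, J.val_constr]
    simp only [hsc, Function.comp_def]
  · intro j
    have h : ∀ v (hv : G.Reach a v),
        Relation.ReflTransGen (fun a b => ∃ i, b = sc a i) 0 (e ⟨v, hv⟩) := by
      intro v hv
      induction hv with
      | refl => rw [he]
      | tail h1 h2 ih =>
        rename_i b c
        refine Relation.ReflTransGen.tail ih ?_
        have hb : (e.symm (e ⟨b, h1⟩)).1 = b := by simp
        rcases h2 with h2 | h2
        · obtain ⟨c, hc⟩ := hcons b h1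
          simp [hG.nsucc_eq_nil hc] at h2
        · have h3 := hvs (e ⟨b, h1⟩)
          rw [hb] at h3
          rw [h3, List.mem_ofFn] at h2
          obtain ⟨i, rfl⟩ := h2
          exact ⟨i, rfl⟩
    have := h _ (e.symm j).2
    simpa using this
  · simp [← he]
  · exact fun j => ⟨hlbl j, by simp only [hsc, hvs]⟩

include ha in
theorem implementable_rec [Fintype C] {J : Interp S} {W : S.D → Polynomial ℕ}
    (hW : W d = Polynomial.X * ∑ c, (1 + W (h c)) + 1)
    (hsem : ∀ c (a : Fin (ar c) → Tm ar) (x : Fin k → Tm ar) (z : Fin l → Tm ar),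
      J.val (.inr d) (.mk c a :: List.ofFn x) (List.ofFn z) =
        J.val (.inr (h c)) (List.ofFn a ++ List.ofFn x)
          (List.ofFn z ++
            List.ofFn fun i => J.val (.inr d) (a i :: List.ofFn x) (List.ofFn z))) :
    Implementable J W d := by
  refine ⟨Set.range fun T => unfRule T ha, ?_, ?_, Or.inl ?_⟩
  · rintro _ ⟨T, rfl⟩
    exact unfRule_ok T ha hW hsem
  · intro G ε u hG hε hu hcons hinj
    obtain ⟨vs, hvs⟩ := exists_eq_ofFn ((hG.nlen u _ hu).trans ha.normal)
    obtain ⟨ws, hws⟩ := exists_eq_ofFn ((hG.slen u _ hu).trans ha.safe)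
    have hmem : vs 0 ∈ G.nsucc u := by simp [hvs]
    obtain ⟨T, ν, h0, hν⟩ := exists_sharedDag hG hε (hcons _ (Or.inl hmem)) (hinj _ hmem)
    refine ⟨_, ⟨T, rfl⟩, _, Graph.isHom_comp_val (G := unfGraph d h k l T) (fun v => match v with
      | .v j => ν j
      | .x i => vs i.succ
      | .z i => ws i
      | _ => u) ?_, rfl⟩
    intro v hv s hs
    rw [unfGraph_reach_y] at hv
    rcases v with _ | j | j | i | i <;> simp at hs hv
    · subst hs
      refine ⟨hu, ?_, ?_⟩
      · simp only [List.map_cons, List.map_ofFn, h0]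
        rw [hvs, List.ofFn_succ]
        rfl
      · simp only [List.map_ofFn]
        exact hws
    · subst hs
      simp only [List.map_ofFn, List.map_nil]
      exact ⟨(hν j).1, hG.nsucc_eq_nil (hν j).1, (hν j).2⟩
  · rintro _ ⟨T, rfl⟩
    exact unfRule_safeUnfolding T ha

end Unfolding

/-! ### Programs for general safe recursive functions -/

/-- Functions on terms together with their numbers of normal and of safe arguments. -/
abbrev Fun (ar : C → ℕ) : Type :=
  Σ k l : ℕ, (Fin k → Tm ar) → (Fin l → Tm ar) → Tm ar

/-- Application to lists of arguments; missing arguments are replaced by `t`. -/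
def Fun.app (t : Tm ar) (u : Fun ar) (xs ys : List (Tm ar)) : Tm ar :=
  u.2.2 (fun i => xs.getD i t) (fun i => ys.getD i t)

theorem Fun.app_mk (t : Tm ar) {k l : ℕ} (f : (Fin k → Tm ar) → (Fin l → Tm ar) → Tm ar)
    {xs ys : List (Tm ar)} {x : Fin k → Tm ar} {y : Fin l → Tm ar} (hx : xs = List.ofFn x)
    (hy : ys = List.ofFn y) : Fun.app t ⟨k, l, f⟩ xs ys = f x y := by
  subst hx hy
  simp [Fun.app]

theorem Fun.fst_eq {u : Fun ar} {k l : ℕ} {f : (Fin k → Tm ar) → (Fin l → Tm ar) → Tm ar}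
    (h : u = ⟨k, l, f⟩) : u.1 = k := by rw [h]

theorem Fun.snd_eq {u : Fun ar} {k l : ℕ} {f : (Fin k → Tm ar) → (Fin l → Tm ar) → Tm ar}
    (h : u = ⟨k, l, f⟩) : u.2.1 = l := by subst h; rfl

section Program

variable {D : Type} (sem : D → Fun ar)

/-- The functions computed by the symbols; constructors compute themselves. -/
def symFun : C ⊕ D → Fun ar
  | .inl c => ⟨0, ar c, fun _ y => .mk c y⟩
  | .inr d => sem d

/-- The signature whose defined symbols are the elements of `D`. -/
abbrev funSignature [Finite D] : Signature ar where
  D := D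
  finite_D := inferInstance
  normal d := (sem d).1
  safe d := (sem d).2.1

theorem funSignature_nar [Finite D] (s : C ⊕ D) : (funSignature sem).nar s = (symFun sem s).1 := by
  cases s <;> rfl

theorem funSignature_sar [Finite D] (s : C ⊕ D) :
    (funSignature sem).sar s = (symFun sem s).2.1 := by
  cases s <;> rfl

/-- The interpretation of the symbols by their functions. -/
abbrev funInterp [Finite D] (t : Tm ar) : Interp (funSignature sem) where
  val s := Fun.app t (symFun sem s)
  val_constr c ys := Fun.app_mk t (k := 0) (x := Fin.elim0) _ (by simp) rfl

variable [Fintype C] (W : D → Polynomial ℕ)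

/-- The polynomial of a symbol; constructors have weight `0`. -/
def symPoly : C ⊕ D → Polynomial ℕ := Sum.elim 0 W

/-- The function of the symbol `d` is defined, by one of the four schemes for which there are
rules, from the functions of other symbols, and its polynomial is the corresponding bound. -/
inductive Justified (d : D) : Prop
  | proj {k l : ℕ} (r : Fin k ⊕ Fin l) (hd : sem d = ⟨k, l, fun x y => Sum.elim x y r⟩)
      (hW : W d = 1)
  | case {l : ℕ} (sel : ∀ c, Option (Fin (ar c) ⊕ Fin l))
      (F : (Fin 0 → Tm ar) → (Fin (l + 1) → Tm ar) → Tm ar) (hd : sem d = ⟨0, l + 1, F⟩)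
      (hF : ∀ x c a y, F x (Fin.cons (.mk c a) y) = (sel c).elim (.mk c a) (Sum.elim a y))
      (hW : W d = 1)
  | comp {k l m q : ℕ} (s : C ⊕ D) (j : Fin m → Fin k) (g : Fin q → D)
      (h : (Fin m → Tm ar) → (Fin q → Tm ar) → Tm ar)
      (G : Fin q → (Fin k → Tm ar) → (Fin l → Tm ar) → Tm ar)
      (hs : symFun sem s = ⟨m, q, h⟩) (hg : ∀ i, sem (g i) = ⟨k, l, G i⟩)
      (hd : sem d = ⟨k, l, fun x y => h (fun i => x (j i)) (fun i => G i x y)⟩)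
      (hW : W d = symPoly W s + ∑ i, W (g i) + q + 2)
  | recursion {k l : ℕ} (h : C → D) (f : (Fin (k + 1) → Tm ar) → (Fin l → Tm ar) → Tm ar)
      (H : ∀ c : C, (Fin (ar c + k) → Tm ar) → (Fin (l + ar c) → Tm ar) → Tm ar)
      (inj : Function.Injective h) (ne : ∀ c, h c ≠ d)
      (hh : ∀ c, sem (h c) = ⟨ar c + k, l + ar c, H c⟩) (hd : sem d = ⟨k + 1, l, f⟩)
      (hf : ∀ (c : C) (x : Fin (ar c) → Tm ar) (y : Fin k → Tm ar) (z : Fin l → Tm ar),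
        f (Fin.cons (Tm.mk c x) y) z =
          H c (Fin.append x y) (Fin.append z (fun i => f (Fin.cons (x i) y) z)))
      (hW : W d = Polynomial.X * ∑ c, (1 + W (h c)) + 1)

variable {sem W}

theorem Justified.implementable [Finite D] (t : Tm ar) {d : D} (h : Justified sem W d) :
    Implementable (funInterp sem t) W d := by
  cases h with
  | proj r hd hW =>
    rename_i k l
    refine implementable_proj (S := funSignature sem) (k := k) (l := l) (Fun.fst_eq hd)
      (Fun.snd_eq hd) hW r fun x y => ?_
    simp only [symFun, hd]
    exact Fun.app_mk t _ rfl rfl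
  | case sel F hd hF hW =>
    refine implementable_case (S := funSignature sem) (Fun.fst_eq hd) (Fun.snd_eq hd) hW sel
      fun c a y => ?_
    simp only [symFun, hd]
    rw [← hF Fin.elim0]
    exact Fun.app_mk t _ (by simp) (by simp [List.ofFn_succ])
  | comp s j g h G hs hg hd hW =>
    rename_i k l m q
    have hj : CompArity (S := funSignature sem) d s k l m q g :=
      ⟨Fun.fst_eq hd, Fun.snd_eq hd, (funSignature_nar sem s).trans (Fun.fst_eq hs),
        (funSignature_sar sem s).trans (Fun.snd_eq hs), fun i => Fun.fst_eq (hg i),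
        fun i => Fun.snd_eq (hg i)⟩
    refine implementable_comp j hj (fun n => ?_) fun x z => ?_
    · have : labWeight (S := funSignature sem) W n (some s) = (symPoly W s).eval n := by
        cases s <;> simp [symPoly, labWeight]
      rw [this, hW]
      simp [Polynomial.eval_finsetSum]
    · simp only [hs]
      simp only [symFun, hd, hg]
      rw [Fun.app_mk t _ rfl rfl]
      exact (Fun.app_mk t _ rfl (by simp only [Fun.app_mk t _ rfl rfl])).symm
  | recursion h f H inj ne hh hd hf hW =>
    have ha : RecArity (S := funSignature sem) d h _ _ :=
      ⟨Fun.fst_eq hd, Fun.snd_eq hd, fun c => Fun.fst_eq (hh c), fun c => Fun.snd_eq (hh c),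
        inj, ne⟩
    refine implementable_rec ha hW fun c a x z => ?_
    simp only [symFun, hd, hh]
    rw [Fun.app_mk t f (x := Fin.cons (.mk c a) x) (by simp [List.ofFn_succ]) rfl, hf]
    refine (Fun.app_mk t _ (by rw [List.ofFn_fin_append]) ?_).symm
    rw [List.ofFn_fin_append]
    congr 2
    funext i
    exact Fun.app_mk t f (x := Fin.cons (a i) x) (by simp [List.ofFn_succ]) rfl

theorem Justified.map {D' : Type} {sem' : D' → Fun ar} {W' : D' → Polynomial ℕ} {ι : D → D'}
    (hι : Function.Injective ι) (hsem : ∀ d, sem' (ι d) = sem d) (hW : ∀ d, W' (ι d) = W d) {d : D}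
    (h : Justified sem W d) : Justified sem' W' (ι d) := by
  cases h with
  | proj r hd hw => exact .proj r ((hsem d).trans hd) ((hW d).trans hw)
  | case sel F hd hF hw => exact .case sel F ((hsem d).trans hd) hF ((hW d).trans hw)
  | comp s j g h G hs hg hd hw =>
    refine .comp (s.map id ι) j (fun i => ι (g i)) h G ?_ (fun i => (hsem _).trans (hg i))
      ((hsem d).trans hd) ?_
    · cases s
      · exact hs
      · exact (hsem _).trans hs
    · have : symPoly W' (s.map id ι) = symPoly W s := by
        cases s
        · rfl
        · exact hW _
      simp only [hW, hw, this]
  | recursion h f H inj ne hh hd hf hw =>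
    refine .recursion (fun c => ι (h c)) f H (hι.comp inj) (fun c => hι.ne (ne c))
      (fun c => (hsem _).trans (hh c)) ((hsem d).trans hd) hf ?_
    simp only [hW, hw]

end Program

variable [Fintype C]

/-- There is a finite program, all of whose symbols are justified, that computes `u`. -/
def Programmable (u : Fun ar) : Prop :=
  ∃ (D : Type) (_ : Finite D) (sem : D → Fun ar) (W : D → Polynomial ℕ) (d : D),
    (∀ d, Justified sem W d) ∧ sem d = u

/-- The disjoint union of finitely many programs can be extended by a new symbol that is defined
from their main symbols. -/
theorem Programmable.extend {ι : Type} [Finite ι] {us : ι → Fun ar}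
    (h : ∀ i, Programmable (us i)) (u : Fun ar) (w : (ι → Polynomial ℕ) → Polynomial ℕ)
    (hj : ∀ (D : Type) (sem : D → Fun ar) (W : D → Polynomial ℕ) (d : D) (ch : ι → D),
      Function.Injective ch → (∀ i, ch i ≠ d) → (∀ i, sem (ch i) = us i) → sem d = u →
      W d = w (fun i => W (ch i)) → Justified sem W d) :
    Programmable u := by
  choose D hD sem W d hjust hd using h
  let sem' : Option (Σ i, D i) → Fun ar := fun o => o.elim u fun p => sem p.1 p.2
  let W' : Option (Σ i, D i) → Polynomial ℕ :=
    fun o => o.elim (w fun i => W i (d i)) fun p => W p.1 p.2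
  refine ⟨Option (Σ i, D i), inferInstance, sem', W', none, ?_, rfl⟩
  rintro (_ | ⟨i, b⟩)
  · refine hj _ sem' W' none (fun i => some ⟨i, d i⟩) (fun i j hij => ?_) (by simp) hd rfl rfl
    exact congrArg Sigma.fst (Option.some_injective _ hij)
  · exact (hjust i b).map (sem' := sem') (W' := W') (ι := fun b => some ⟨i, b⟩) (fun a b hab =>
      sigma_mk_injective (Option.some_injective _ hab)) (fun _ => rfl) (fun _ => rfl)

theorem programmable_proj {k l : ℕ} (r : Fin k ⊕ Fin l) :
    Programmable (ar := ar) ⟨k, l, fun x y => Sum.elim x y r⟩ :=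
  Programmable.extend (ι := Empty) (us := fun i => i.elim) (fun i => i.elim) _ (fun _ => 1)
    fun _ _ _ _ _ _ _ _ hd hW => .proj r hd hW

theorem programmable_case {l : ℕ} (sel : ∀ c, Option (Fin (ar c) ⊕ Fin l))
    (F : (Fin 0 → Tm ar) → (Fin (l + 1) → Tm ar) → Tm ar)
    (hF : ∀ x c a y, F x (Fin.cons (.mk c a) y) = (sel c).elim (.mk c a) (Sum.elim a y)) :
    Programmable ⟨0, l + 1, F⟩ :=
  Programmable.extend (ι := Empty) (us := fun i => i.elim) (fun i => i.elim) _ (fun _ => 1)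
    fun _ _ _ _ _ _ _ _ hd hW => .case sel F hd hF hW

theorem programmable_constr_comp {k l : ℕ} (c : C)
    {G : Fin (ar c) → (Fin k → Tm ar) → (Fin l → Tm ar) → Tm ar}
    (hG : ∀ i, Programmable ⟨k, l, G i⟩) :
    Programmable ⟨k, l, fun x y => .mk c fun i => G i x y⟩ :=
  Programmable.extend hG _ (fun w => 0 + ∑ i, w i + ar c + 2)
    fun _ _ _ _ ch _ _ hus hd hW =>
      .comp (.inl c) Fin.elim0 ch (fun _ y => .mk c y) G rfl hus hd hW

theorem programmable_comp {k l m q : ℕ} (j : Fin m → Fin k)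
    {h : (Fin m → Tm ar) → (Fin q → Tm ar) → Tm ar}
    {G : Fin q → (Fin k → Tm ar) → (Fin l → Tm ar) → Tm ar}
    (hh : Programmable ⟨m, q, h⟩) (hG : ∀ i, Programmable ⟨k, l, G i⟩) :
    Programmable ⟨k, l, fun x y => h (fun i => x (j i)) (fun i => G i x y)⟩ :=
  Programmable.extend (ι := Option (Fin q))
    (us := fun o => o.elim ⟨m, q, h⟩ fun i => ⟨k, l, G i⟩)
    (by rintro (_ | i); exacts [hh, hG i]) _ (fun w => w none + ∑ i, w (some i) + q + 2)
    fun _ _ _ _ ch _ _ hus hd hW =>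
      .comp (.inr (ch none)) j (fun i => ch (some i)) h G (hus none) (fun i => hus (some i)) hd hW

theorem programmable_recursion {k l : ℕ} {f : (Fin (k + 1) → Tm ar) → (Fin l → Tm ar) → Tm ar}
    {H : ∀ c : C, (Fin (ar c + k) → Tm ar) → (Fin (l + ar c) → Tm ar) → Tm ar}
    (hH : ∀ c, Programmable ⟨ar c + k, l + ar c, H c⟩)
    (hf : ∀ (c : C) (x : Fin (ar c) → Tm ar) (y : Fin k → Tm ar) (z : Fin l → Tm ar),
      f (Fin.cons (Tm.mk c x) y) z =
        H c (Fin.append x y) (Fin.append z (fun i => f (Fin.cons (x i) y) z))) :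
    Programmable ⟨k + 1, l, f⟩ :=
  Programmable.extend hH _ (fun w => Polynomial.X * ∑ c, (1 + w c) + 1)
    fun _ _ _ _ ch hinj hne hus hd hW => .recursion ch f H hinj hne hus hd hf hW

/-- Every general safe recursive function is computed by a finite program. -/
theorem GSR.programmable {n : ℕ} {e : Fin n ≃ C} {k l : ℕ}
    {f : (Fin k → Tm ar) → (Fin l → Tm ar) → Tm ar} (hf : GSR ar e k l f) :
    Programmable ⟨k, l, f⟩ := by
  induction hf with
  | const k l c hc =>
    have h := programmable_constr_comp (k := k) (l := l) c
      (G := fun i => (Fin.cast hc i).elim0) (fun i => (Fin.cast hc i).elim0)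
    convert h using 7
    rename_i i
    exact (Fin.cast hc i).elim0
  | constr c hc => exact programmable_constr_comp c fun i => programmable_proj (.inr i)
  | projNormal k l j => exact programmable_proj (.inl j)
  | projSafe k l j => exact programmable_proj (.inr j)
  | predConst c hc => exact programmable_proj (.inr 0)
  | pred c j =>
    classical
    refine programmable_case
      (fun b => if h : b = c then some (.inl (j.cast (congrArg ar h.symm))) else none) _
      fun x b a y => ?_
    simp only [Fin.cons_zero, Tm.pred]
    split <;> rfl
  | cond => exact programmable_case (fun c => some (.inr (e.symm c))) _ fun x c a y => rfl
  | comp j h g _ _ ih ihg => exact programmable_comp j ih ihg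
  | safeRec f h _ hf ih => exact programmable_recursion ih hf

end GRS

end

theorem corollaryc {C : Type} {n : ℕ} (ar : C → ℕ) (e : Fin n ≃ C) (hC : ∃ c, ar c = 0)
    (k l : ℕ) (f : (Fin k → GRS.Tm ar) → (Fin l → GRS.Tm ar) → GRS.Tm ar)
    (hf : GRS.GSR ar e k l f) :
    ∃ (S : GRS.Signature ar) (𝒢 : Set (GRS.Rule S)) (p : Polynomial ℕ),
      GRS.IsConstructorSystem 𝒢 ∧ GRS.IsSafeRecursive 𝒢 ∧ GRS.Defines 𝒢 f ∧
      ∀ (G H : GRS.TermGraph S) (m : ℕ), G.Closed → G.Basic → GRS.Steps 𝒢 m G H →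
        m ≤ p.eval G.normalPart.ncard ∧
        H.size ≤ p.eval G.normalPart.ncard + (G.normalPartᶜ).ncard := by
  obtain ⟨c, hc⟩ := hC
  let t : GRS.Tm ar := .mk c fun i => (Fin.cast hc i).elim0
  have : Fintype C := Fintype.ofEquiv _ e
  obtain ⟨D, hD, sem, W, d, hW, hd⟩ := hf.programmable
  exact ⟨GRS.funSignature sem, GRS.exists_system (J := GRS.funInterp sem t)
    (fun d => (hW d).implementable t) d (GRS.Fun.fst_eq hd) (GRS.Fun.snd_eq hd)
    fun x y => by simp only [GRS.symFun, hd]; exact GRS.Fun.app_mk t f rfl rfl⟩
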